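/- Let $\widetilde{Rat_3}$ be the moduli space of charge three lumps on $\mathbb{R}P^2$: the set of rational maps $R:\mathbb{C}\cup\{\infty\}\to\mathbb{C}\cup\{\infty\}$ of degree $3$ with $R(-1/\bar z)=-1/\overline{R(z)}$ for all $z$. These are exactly the maps $R_a(z)=\sum_{k=0}^3a_kz^k\big/\sum_{k=0}^3(-1)^k\bar a_{3-k}z^k$, where $a\in\mathbb{C}^4$ is such that numerator and denominator have no common root; $a$ is unique up to a nonzero real factor, so $\widetilde{Rat_3}$ is an open subset of $\mathbb{R}P^7$, a $7$-dimensional manifold. Its $L^2$ metric $g$ is given in local coordinates $y$ by $$g_{kl}=\int_{\mathbb{C}}\frac{\Re\big(\partial_{y_k}R\;\overline{\partial_{y_l}R}\big)}{(1+|R|^2)^2}\,\frac{dA}{(1+|z|^2)^2},\qquad dA=dx\,dy .$$ (1) These integrals converge. (2) For $c\ge 0$, $c\ne1$, let $R_c(z)=\frac{z^3+cz}{cz^2+1}$. On the orbits $z\mapsto M(R_c(Uz))$, $U,M\in SU(2)$ acting by Möbius transformations, the $L^2$ metric is $$g=C(c)\,dc^2+\sum_{i=1}^3\big(A_{ii}(c)\,\sigma_i^2+D_{ii}(c)\,\eta_i^2+F_{ii}(c)\,\sigma_i\eta_i\big),$$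 where $dU\,U^{-1}=\sum_i\sigma_i\,\tfrac{i}{2}\tau_i$ and $M^{-1}dM=\sum_i\eta_i\,\tfrac{i}{2}\tau_i$ with the Pauli matrices $\tau_i$, and, with $d\nu=\frac{1}{(1+|R_c|^2)^2}\frac{dA}{(1+|z|^2)^2}$ and $v_1(z)=\tfrac i2(1-z^2)$, $v_2(z)=\tfrac12(1+z^2)$, $v_3(z)=iz$, $$C=\int_{\mathbb{C}}|\partial_cR_c|^2d\nu,\quad A_{ii}=\int_{\mathbb{C}}|v_i(z)R_c'(z)|^2d\nu,\quad D_{ii}=\int_{\mathbb{C}}|v_i(R_c)|^2d\nu,\quad F_{ii}=2\int_{\mathbb{C}}\Re\big(v_i(z)R_c'(z)\overline{v_i(R_c)}\big)d\nu .$$ (3) The Riemannian volume of $(\widetilde{Rat_3},g)$ is finite. -/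

import Mathlib

open MeasureTheory Polynomial
open scoped OnePoint ComplexConjugate

noncomputable section

namespace Lump

/-! ### Rational maps of the Riemann sphere -/

/-- The antipodal map `z ↦ -1 / conj z` of the Riemann sphere. -/
def antipode : OnePoint ℂ → OnePoint ℂ
  | none => ((0 : ℂ) : OnePoint ℂ)
  | some z => if z = 0 then ∞ else ((-1 / conj z : ℂ) : OnePoint ℂ)

/-- The self-map `p / q` of the Riemann sphere, for polynomials `p`, `q` without common root. -/
def ratMap (p q : ℂ[X]) : OnePoint ℂ → OnePoint ℂ
  | none =>
      if q.coeff (max p.natDegree q.natDegree) = 0 then ∞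
      else ((p.coeff (max p.natDegree q.natDegree) /
        q.coeff (max p.natDegree q.natDegree) : ℂ) : OnePoint ℂ)
  | some z => if q.eval z = 0 then ∞ else ((p.eval z / q.eval z : ℂ) : OnePoint ℂ)

/-- The set of rational maps of degree `N` of the Riemann sphere. -/
def Rat (N : ℕ) : Set (OnePoint ℂ → OnePoint ℂ) :=
  {R | ∃ p q : ℂ[X], IsCoprime p q ∧ max p.natDegree q.natDegree = N ∧ R = ratMap p q}

/-- The moduli space of charge `N` lumps on the real projective plane: the rational maps of
degree `N` that commute with the antipodal map. -/
def RatTilde (N : ℕ) : Set (OnePoint ℂ → OnePoint ℂ) :=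
  {R | R ∈ Rat N ∧ ∀ z, R (antipode z) = antipode (R z)}

/-! ### The `L²` metric -/

/-- A map of the sphere in the affine coordinate `z` (with value `0` at its poles). -/
def affine (R : OnePoint ℂ → OnePoint ℂ) (z : ℂ) : ℂ :=
  (R (z : OnePoint ℂ)).elim 0 id

/-- The integrand of the `L²` inner product of two infinitesimal deformations `u`, `v` of the
map `R`, written in the affine coordinate. -/
def l2Density (R : OnePoint ℂ → OnePoint ℂ) (u v : ℂ → ℂ) (z : ℂ) : ℝ :=
  (u z * conj (v z)).re / ((1 + ‖affine R z‖ ^ 2) ^ 2 * (1 + ‖z‖ ^ 2) ^ 2)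

/-- The `L²` inner product of two infinitesimal deformations `u`, `v` of the map `R`. -/
def l2Inner (R : OnePoint ℂ → OnePoint ℂ) (u v : ℂ → ℂ) : ℝ :=
  ∫ z : ℂ, l2Density R u v z

/-- The infinitesimal deformation `∂Φ/∂y_k` of a family of maps with parameters `y ∈ ℝⁿ`. -/
def partialField {n : ℕ} (Φ : (Fin n → ℝ) → OnePoint ℂ → OnePoint ℂ) (y : Fin n → ℝ)
    (k : Fin n) (z : ℂ) : ℂ :=
  lineDeriv ℝ (fun y' => affine (Φ y') z) y (Pi.single k 1)

/-- The matrix of the `L²` metric in the coordinates of a family of maps. -/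
def l2Gram {n : ℕ} (Φ : (Fin n → ℝ) → OnePoint ℂ → OnePoint ℂ) (y : Fin n → ℝ) :
    Matrix (Fin n) (Fin n) ℝ :=
  Matrix.of fun k l => l2Inner (Φ y) (partialField Φ y k) (partialField Φ y l)

/-- The Riemannian volume, for the `L²` metric, of a manifold of maps with a finite atlas of
coordinate systems `chart j : dom j → M`. The part of the manifold that lies in the `j`-th
coordinate patch and in no earlier one contributes the integral of `√|det g|` in the `j`-th
coordinates. -/
def atlasVolume {m n : ℕ} (dom : Fin m → Set (Fin n → ℝ))
    (chart : Fin m → (Fin n → ℝ) → OnePoint ℂ → OnePoint ℂ) : ENNReal :=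
  ∑ j, ∫⁻ y in {y | y ∈ dom j ∧ ∀ i < j, chart j y ∉ chart i '' dom i},
    ENNReal.ofReal (Real.sqrt |(l2Gram (chart j) y).det|)

/-! ### The atlas of the moduli space of charge three lumps

The maps that commute with the antipodal map are `∑ a_k z^k / ∑ (-1)^k conj(a_{3-k}) z^k` with
`a ∈ ℂ⁴ = ℝ⁸`, and `a` is unique up to a nonzero real factor. So the moduli space is an open subset
of the real projective space of dimension 7; its coordinate systems are the eight affine
ones. Each is restricted to a cube; a representative with largest coordinate `1` shows that the
restricted ones still cover the moduli space (`iUnion_lumpChart`). -/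

/-- The point of `ℂ⁴` with real parts `x₀, …, x₃` and imaginary parts `x₄, …, x₇`. -/
def coeffs (x : Fin 8 → ℝ) (k : Fin 4) : ℂ :=
  ⟨x (Fin.castAdd 4 k), x (Fin.natAdd 4 k)⟩

/-- The numerator `∑ a_k z^k`. -/
def num (a : Fin 4 → ℂ) : ℂ[X] := ∑ k : Fin 4, C (a k) * X ^ (k : ℕ)

/-- The denominator `∑ (-1)^k conj(a_{3-k}) z^k`. -/
def den (a : Fin 4 → ℂ) : ℂ[X] := ∑ k : Fin 4, C ((-1) ^ (k : ℕ) * conj (a k.rev)) * X ^ (k : ℕ)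

/-- The coefficient vector whose `j`-th real coordinate is `1`, and whose other coordinates
are `y`. -/
def lumpCoeffs (j : Fin 8) (y : Fin 7 → ℝ) : Fin 4 → ℂ :=
  coeffs (j.insertNth (α := fun _ => ℝ) 1 y)

/-- The `j`-th affine parametrization of the moduli space. -/
def lumpChart (j : Fin 8) (y : Fin 7 → ℝ) : OnePoint ℂ → OnePoint ℂ :=
  ratMap (num (lumpCoeffs j y)) (den (lumpCoeffs j y))

/-- The domain of the `j`-th parametrization. -/
def lumpDom (j : Fin 8) : Set (Fin 7 → ℝ) :=
  {y | (∀ k, |y k| < 2) ∧ IsCoprime (num (lumpCoeffs j y)) (den (lumpCoeffs j y))}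

lemma antipode_coe (z : ℂ) : antipode (z : OnePoint ℂ) =
    if z = 0 then ∞ else ((-1 / conj z : ℂ) : OnePoint ℂ) := rfl

lemma antipode_infty : antipode ∞ = ((0 : ℂ) : OnePoint ℂ) := rfl

lemma ratMap_coe (p q : ℂ[X]) (z : ℂ) : ratMap p q (z : OnePoint ℂ) =
    if q.eval z = 0 then ∞ else ((p.eval z / q.eval z : ℂ) : OnePoint ℂ) := rfl

lemma ratMap_infty (p q : ℂ[X]) {n : ℕ} (h : max p.natDegree q.natDegree = n) : ratMap p q ∞ =
    if q.coeff n = 0 then ∞ else ((p.coeff n / q.coeff n : ℂ) : OnePoint ℂ) := by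
  subst h; rfl

lemma ratMap_C_mul (p q : ℂ[X]) {r : ℂ} (hr : r ≠ 0) :
    ratMap (C r * p) (C r * q) = ratMap p q := by
  funext z
  induction z using OnePoint.rec with
  | infty =>
    rw [ratMap_infty (C r * p) (C r * q) (n := max p.natDegree q.natDegree)
      (by rw [natDegree_C_mul hr, natDegree_C_mul hr]), ratMap_infty p q rfl]
    simp [hr, mul_div_mul_left]
  | coe z => simp [ratMap_coe, hr, mul_div_mul_left]

lemma num_eval (a : Fin 4 → ℂ) (z : ℂ) :
    (num a).eval z = a 0 + a 1 * z + a 2 * z ^ 2 + a 3 * z ^ 3 := by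
  simp [num, Fin.sum_univ_four]

lemma den_eq (a : Fin 4 → ℂ) :
    den a = num ![conj (a 3), -conj (a 2), conj (a 1), -conj (a 0)] := by
  simp [den, num, Fin.sum_univ_four, show Fin.rev (0 : Fin 4) = 3 from rfl,
    show Fin.rev (1 : Fin 4) = 2 from rfl, show Fin.rev (2 : Fin 4) = 1 from rfl,
    show Fin.rev (3 : Fin 4) = 0 from rfl, pow_succ]

lemma den_eval (a : Fin 4 → ℂ) (z : ℂ) : (den a).eval z =
    conj (a 3) - conj (a 2) * z + conj (a 1) * z ^ 2 - conj (a 0) * z ^ 3 := by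
  rw [den_eq, num_eval]; simp; ring

lemma num_coeff (a : Fin 4 → ℂ) (k : Fin 4) : (num a).coeff k = a k := by
  fin_cases k <;> simp [num, Fin.sum_univ_four, coeff_X, coeff_C, coeff_X_pow]

lemma num_natDegree (a : Fin 4 → ℂ) : (num a).natDegree ≤ 3 := by
  refine natDegree_sum_le_of_forall_le _ _ fun k _ => ?_
  exact (natDegree_C_mul_X_pow_le _ _).trans (by omega)

lemma eq_num {p : ℂ[X]} (hp : p.natDegree ≤ 3) : p = num fun k => p.coeff k := by
  ext n
  by_cases hn : n < 4
  · exact (num_coeff (fun k : Fin 4 => p.coeff k) ⟨n, hn⟩).symm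
  · rw [coeff_eq_zero_of_natDegree_lt (by omega),
      coeff_eq_zero_of_natDegree_lt ((num_natDegree _).trans_lt (by omega))]

lemma num_smul (r : ℂ) (a : Fin 4 → ℂ) : num (fun k => r * a k) = C r * num a := by
  simp [num, Finset.mul_sum, mul_assoc]

lemma den_smul (r : ℂ) (a : Fin 4 → ℂ) : den (fun k => r * a k) = C (conj r) * den a := by
  simp only [den, Finset.mul_sum]
  refine Finset.sum_congr rfl fun k _ => ?_
  simp only [map_mul]; ring

lemma num_antipode (a : Fin 4 → ℂ) {z : ℂ} (hz : z ≠ 0) :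
    (num a).eval (-1 / conj z) = conj (-(den a).eval z / z ^ 3) := by
  have : conj z ≠ 0 := by simpa using hz
  rw [num_eval, den_eval]; simp only [map_div₀, map_neg, map_sub, map_add, map_mul, map_pow,
    Complex.conj_conj]; field_simp; ring

lemma den_antipode (a : Fin 4 → ℂ) {z : ℂ} (hz : z ≠ 0) :
    (den a).eval (-1 / conj z) = conj ((num a).eval z / z ^ 3) := by
  have : conj z ≠ 0 := by simpa using hz
  rw [num_eval, den_eval]; simp only [map_div₀, map_add, map_mul, map_pow]; field_simp; ring

lemma isCoprime_iff (p q : ℂ[X]) :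
    IsCoprime p q ↔ ∀ z : ℂ, ¬ (p.eval z = 0 ∧ q.eval z = 0) := by
  rw [Polynomial.isCoprime_iff_aeval_ne_zero_of_isAlgClosed ℂ ℂ]
  simp only [aeval_def, Algebra.algebraMap_self, eval₂_id, ne_eq, not_and_or]

lemma max_natDegree {a : Fin 4 → ℂ} (h : IsCoprime (num a) (den a)) :
    max (num a).natDegree (den a).natDegree = 3 := by
  have h0 := (isCoprime_iff _ _).1 h 0
  rw [num_eval, den_eval] at h0
  simp only [mul_zero, add_zero, ne_eq, OfNat.ofNat_ne_zero, not_false_eq_true, zero_pow, sub_zero,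
    map_eq_zero] at h0
  have h1 := num_natDegree a
  have h2 : (den a).natDegree ≤ 3 := by rw [den_eq]; exact num_natDegree _
  apply le_antisymm (max_le h1 h2)
  by_cases h3 : a 3 = 0
  · refine le_max_of_le_right (le_natDegree_of_ne_zero ?_)
    rw [den_eq]
    refine (num_coeff _ 3).trans_ne ?_
    simpa using fun h => h0 ⟨h, h3⟩
  · refine le_max_of_le_left (le_natDegree_of_ne_zero ?_)
    exact (num_coeff _ 3).trans_ne h3

lemma ratMap_mem {a : Fin 4 → ℂ} (h : IsCoprime (num a) (den a)) :
    ratMap (num a) (den a) ∈ RatTilde 3 := by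
  refine ⟨⟨_, _, h, max_natDegree h, rfl⟩, fun z => ?_⟩
  have hc := (isCoprime_iff _ _).1 h
  have hn3 : (num a).coeff 3 = a 3 := num_coeff a 3
  have hd3 : (den a).coeff 3 = -conj (a 0) := by
    rw [den_eq]; exact num_coeff _ 3
  induction z using OnePoint.rec with
  | infty =>
    have h0 := hc 0
    rw [antipode_infty, ratMap_coe, ratMap_infty _ _ (max_natDegree h), hn3, hd3]
    rw [num_eval, den_eval] at *
    simp only [mul_zero, add_zero, ne_eq, OfNat.ofNat_ne_zero, not_false_eq_true, zero_pow, sub_zero,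
      map_eq_zero, neg_eq_zero] at *
    by_cases h3 : a 3 = 0
    · have h00 : a 0 ≠ 0 := fun h => h0 ⟨h, h3⟩
      simp [h3, h00, antipode_coe]
    · by_cases h00 : a 0 = 0
      · simp [h3, h00, antipode_infty]
      · have : conj (a 0) ≠ 0 := by simpa using h00
        have : conj (a 3) ≠ 0 := by simpa using h3
        simp [h3, h00, antipode_coe]
        field_simp
  | coe z =>
    by_cases hz : z = 0
    · subst hz
      have h0 := hc 0
      rw [antipode_coe, if_pos rfl, ratMap_coe, ratMap_infty _ _ (max_natDegree h), hn3, hd3]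
      rw [num_eval, den_eval] at *
      simp only [mul_zero, add_zero, ne_eq, OfNat.ofNat_ne_zero, not_false_eq_true, zero_pow,
        sub_zero, map_eq_zero, neg_eq_zero] at *
      by_cases h3 : a 3 = 0
      · have h00 : a 0 ≠ 0 := fun h => h0 ⟨h, h3⟩
        simp [h3, h00, antipode_infty]
      · by_cases h00 : a 0 = 0
        · simp [h3, h00, antipode_coe]
        · have : conj (a 0) ≠ 0 := by simpa using h00
          have : conj (a 3) ≠ 0 := by simpa using h3
          simp [h3, h00, antipode_coe]
          field_simp
    · have h0 := hc z
      rw [antipode_coe, if_neg hz, ratMap_coe, ratMap_coe, num_antipode a hz, den_antipode a hz]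
      by_cases h1 : (num a).eval z = 0
      · have h2 : (den a).eval z ≠ 0 := fun h => h0 ⟨h1, h⟩
        simp [h1, h2, antipode_coe]
      · have h1' : conj ((num a).eval z) ≠ 0 := by simpa using h1
        have hz' : conj z ≠ 0 := by simpa using hz
        by_cases h2 : (den a).eval z = 0
        · simp [h1, h2, hz, antipode_infty]
        · have h2' : conj ((den a).eval z) ≠ 0 := by simpa using h2
          simp [h1, h2, hz, antipode_coe]
          field_simp

lemma cross_eq {p q p' q' : ℂ[X]} (hq : q ≠ 0) (hq' : q' ≠ 0) (h : ratMap p q = ratMap p' q') :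
    p * q' = p' * q := by
  refine eq_of_infinite_eval_eq _ _ ?_
  have hfin : {z : ℂ | (q * q').eval z = 0}.Finite := by
    simpa [IsRoot] using (finite_setOfPred_isRoot (mul_ne_zero hq hq'))
  refine (hfin.infinite_compl).mono fun z hz => ?_
  simp only [Set.mem_compl_iff, Set.mem_ofPred_eq, eval_mul, mul_eq_zero, not_or] at hz
  have := congrFun h (z : OnePoint ℂ)
  rw [ratMap_coe, ratMap_coe, if_neg hz.1, if_neg hz.2, OnePoint.coe_eq_coe,
    div_eq_div_iff hz.1 hz.2] at this
  simpa using this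

lemma den_ne_zero {a : Fin 4 → ℂ} (h : IsCoprime (num a) (den a)) : den a ≠ 0 := by
  intro h0
  rw [h0, isCoprime_zero_right] at h
  have : (num a).natDegree = 0 := natDegree_eq_zero_of_isUnit h
  have ha : ∀ k : Fin 4, a k = 0 := by
    intro k
    have : (den a).coeff (k.rev : Fin 4) = 0 := by rw [h0]; simp
    rw [den_eq, num_coeff] at this
    fin_cases k <;> simpa [Fin.rev] using this
  have : num a = 0 := by simp [num, ha]
  rw [this] at h
  exact not_isUnit_zero h

lemma eq_real_smul {a b : Fin 4 → ℂ} (ha : IsCoprime (num a) (den a))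
    (hb : IsCoprime (num b) (den b)) (h : ratMap (num a) (den a) = ratMap (num b) (den b)) :
    ∃ s : ℝ, ∀ k, b k = (s : ℂ) * a k := by
  have hx := cross_eq (den_ne_zero ha) (den_ne_zero hb) h
  obtain ⟨u, hu⟩ : den a ∣ den b := ha.symm.dvd_of_dvd_mul_left ⟨num b, by rw [hx, mul_comm]⟩
  have hnu : num b = num a * u := by
    have : den a * num b = den a * (num a * u) := by
      rw [mul_comm (den a), ← hx, hu]; ring
    exact mul_left_cancel₀ (den_ne_zero ha) this
  have hunit : IsUnit u := hb.isUnit_of_dvd' ⟨num a, by rw [hnu]; ring⟩ ⟨den a, by rw [hu]; ring⟩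
  obtain ⟨r, hr, rfl⟩ := Polynomial.isUnit_iff.1 hunit
  have hab : ∀ k, b k = r * a k := fun k => by
    rw [← num_coeff b k, hnu, coeff_mul_C, num_coeff, mul_comm]
  have hr' : conj r = r := by
    rw [show b = fun k => r * a k from funext hab, den_smul, mul_comm] at hu
    exact C_injective (mul_left_cancel₀ (den_ne_zero ha) hu)
  obtain ⟨s, rfl⟩ := Complex.conj_eq_iff_real.1 hr'
  exact ⟨s, hab⟩

/-- Each parametrization is injective. -/
theorem lumpChart_injOn (j : Fin 8) : Set.InjOn (lumpChart j) (lumpDom j) := by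
  rintro y ⟨-, hy⟩ y' ⟨-, hy'⟩ h
  obtain ⟨s, hab⟩ := eq_real_smul hy hy' h
  have key : ∀ i : Fin 8, j.insertNth (α := fun _ => ℝ) 1 y' i =
      s * j.insertNth (α := fun _ => ℝ) 1 y i := by
    refine Fin.addCases (m := 4) (n := 4) (fun k => ?_) (fun k => ?_)
    · have := congrArg Complex.re (hab k)
      rwa [Complex.re_ofReal_mul] at this
    · have := congrArg Complex.im (hab k)
      rwa [Complex.im_ofReal_mul] at this
  have hs : s = 1 := by
    have := key j
    rw [Fin.insertNth_apply_same, Fin.insertNth_apply_same, mul_one] at this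
    exact this.symm
  funext k
  have := key (j.succAbove k)
  rw [Fin.insertNth_apply_succAbove, Fin.insertNth_apply_succAbove, hs, one_mul] at this
  exact this.symm

/-- The domains of the parametrizations are open. -/
theorem isOpen_lumpDom (j : Fin 8) : IsOpen (lumpDom j) := by
  have hcoef : ∀ k, Continuous fun y => lumpCoeffs j y k := by
    intro k
    have hi : ∀ i : Fin 8, Continuous fun y : Fin 7 → ℝ =>
        j.insertNth (α := fun _ => ℝ) 1 y i := by
      intro i
      rcases Fin.eq_self_or_eq_succAbove j i with rfl | ⟨k, rfl⟩
      · simpa using continuous_const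
      · simpa using continuous_apply k
    have : (fun y => lumpCoeffs j y k) = fun y =>
        ((j.insertNth (α := fun _ => ℝ) 1 y (Fin.castAdd 4 k) : ℝ) : ℂ) +
        ((j.insertNth (α := fun _ => ℝ) 1 y (Fin.natAdd 4 k) : ℝ) : ℂ) * Complex.I := by
      funext y; exact Complex.mk_eq_add_mul_I _ _
    rw [this]
    have := hi (Fin.castAdd 4 k)
    have := hi (Fin.natAdd 4 k)
    fun_prop
  have hcl : IsClosed {y : Fin 7 → ℝ | ∃ z ∈ Metric.closedBall (0 : ℂ) 1,
      (num (lumpCoeffs j y)).eval z = 0 ∧ (den (lumpCoeffs j y)).eval z = 0} := by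
    have := (isClosedMap_fst_of_compactSpace (X := Fin 7 → ℝ) (Y := Metric.closedBall (0 : ℂ) 1))
      {x | (num (lumpCoeffs j x.1)).eval (x.2 : ℂ) = 0 ∧ (den (lumpCoeffs j x.1)).eval (x.2 : ℂ) = 0}
      (by
        have h0 := hcoef 0
        have h1 := hcoef 1
        have h2 := hcoef 2
        have h3 := hcoef 3
        simp only [num_eval, den_eval]
        refine (isClosed_eq ?_ continuous_const).inter (isClosed_eq ?_ continuous_const)
        · fun_prop
        · have := Complex.continuous_conj
          fun_prop)
    convert this using 1
    ext y
    constructor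
    · rintro ⟨z, hz, h⟩
      exact ⟨(y, ⟨z, hz⟩), h, rfl⟩
    · rintro ⟨⟨y', z⟩, h, rfl⟩
      exact ⟨z, z.2, h⟩
  have : lumpDom j = {y | ∀ k, |y k| < 2} ∩ {y : Fin 7 → ℝ | ∃ z ∈ Metric.closedBall (0 : ℂ) 1,
      (num (lumpCoeffs j y)).eval z = 0 ∧ (den (lumpCoeffs j y)).eval z = 0}ᶜ := by
    ext y
    simp only [lumpDom, isCoprime_iff, Set.mem_ofPred_eq, Set.mem_inter_iff, Set.mem_compl_iff]
    refine and_congr_right fun _ => ⟨fun h ⟨z, _, hz⟩ => h z hz, fun h z hz => ?_⟩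
    by_cases hz1 : ‖z‖ ≤ 1
    · exact h ⟨z, by simpa using hz1, hz⟩
    · have hz0 : z ≠ 0 := by rintro rfl; simp at hz1
      refine h ⟨-1 / conj z, ?_, ?_, ?_⟩
      · simp only [mem_closedBall_zero_iff, norm_div, norm_neg, norm_one, RCLike.norm_conj]
        exact (div_le_one (by positivity)).2 (not_le.1 hz1).le
      · rw [num_antipode _ hz0, hz.2]; simp
      · rw [den_antipode _ hz0, hz.1]; simp
  rw [this]
  refine IsOpen.inter ?_ hcl.isOpen_compl
  rw [Set.ofPred_forall]
  exact isOpen_iInter_of_finite fun k => isOpen_lt (by fun_prop) continuous_const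

lemma exists_coeffs {R : OnePoint ℂ → OnePoint ℂ} (hR : R ∈ RatTilde 3) :
    ∃ a : Fin 4 → ℂ, IsCoprime (num a) (den a) ∧ R = ratMap (num a) (den a) := by
  obtain ⟨⟨p, q, hpq, hdeg, rfl⟩, hanti⟩ := hR
  have hp0 : p ≠ 0 := by
    rintro rfl
    have := natDegree_eq_zero_of_isUnit (isCoprime_zero_left.1 hpq)
    simp [this] at hdeg
  have hq0 : q ≠ 0 := by
    rintro rfl
    have := natDegree_eq_zero_of_isUnit (isCoprime_zero_right.1 hpq)
    simp [this] at hdeg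
  obtain ⟨b, rfl⟩ : ∃ b, p = num b := ⟨_, eq_num (hdeg ▸ le_max_left _ _)⟩
  obtain ⟨d, rfl⟩ : ∃ d, q = num d := ⟨_, eq_num (hdeg ▸ le_max_right _ _)⟩
  have hid : den b * num b = -(den d * num d) := by
    refine eq_of_infinite_eval_eq _ _ ?_
    have hfin : {z : ℂ | (X * num b * num d).eval z = 0}.Finite := by
      simpa [IsRoot] using (finite_setOfPred_isRoot (mul_ne_zero (mul_ne_zero X_ne_zero hp0) hq0))
    refine (hfin.infinite_compl).mono fun z hz => ?_
    simp only [Set.mem_compl_iff, Set.mem_ofPred_eq, eval_mul, eval_X, mul_eq_zero, not_or] at hz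
    obtain ⟨⟨hz, h1⟩, h2⟩ := hz
    have h1' : conj ((num b).eval z) ≠ 0 := by simpa using h1
    have h2' : conj ((num d).eval z) ≠ 0 := by simpa using h2
    have hz' : conj z ≠ 0 := by simpa using hz
    have := hanti (z : OnePoint ℂ)
    rw [antipode_coe, if_neg hz, ratMap_coe, ratMap_coe, if_neg h2, antipode_coe,
      if_neg (div_ne_zero h1 h2)] at this
    split_ifs at this with h3
    · exact absurd this (OnePoint.infty_ne_coe _)
    · rw [OnePoint.coe_eq_coe, div_eq_iff h3, num_antipode b hz, num_antipode d hz] at this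
      simp only [map_div₀, map_neg, map_pow] at this
      field_simp at this
      simp only [Set.mem_ofPred_eq, eval_mul, eval_neg]
      apply (starRingEnd ℂ).injective
      simp only [map_mul, map_neg]
      linear_combination -this
  obtain ⟨s, hs⟩ : num d ∣ den b := hpq.symm.dvd_of_dvd_mul_right (by
    rw [hid]; exact (dvd_mul_left _ _).neg_right)
  have hs' : den d = -(s * num b) := by
    apply mul_left_cancel₀ hq0
    rw [hs] at hid
    linear_combination hid
  have hcoeff : ∀ a : Fin 4 → ℂ, ∀ k : Fin 4, (den a).coeff k = (-1) ^ (k : ℕ) * conj (a k.rev) := by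
    intro a k
    rw [den_eq, num_coeff]
    fin_cases k <;> simp [Fin.rev, pow_succ]
  have hden : ∀ a, num a ≠ 0 → den a ≠ 0 := by
    intro a ha h0
    apply ha
    have : ∀ k, a k = 0 := fun k => by
      have := hcoeff a k.rev
      rw [h0, Fin.rev_rev] at this
      simpa using this
    simp [num, this]
  have hdn : ∀ a, (den a).natDegree ≤ 3 := fun a => by rw [den_eq]; exact num_natDegree _
  have hs0 : s ≠ 0 := by
    rintro rfl
    exact hden b hp0 (by rw [hs, mul_zero])
  have hsd : s.natDegree = 0 := by
    rcases max_choice (num b).natDegree (num d).natDegree with h | h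
    · have h1 := hdn d
      rw [hs', natDegree_neg, natDegree_mul hs0 hp0] at h1
      omega
    · have h1 := hdn b
      rw [hs, natDegree_mul hq0 hs0] at h1
      omega
  obtain ⟨r, rfl⟩ : ∃ r, s = C r := ⟨_, eq_C_of_natDegree_eq_zero hsd⟩
  have hr0 : r ≠ 0 := by rintro rfl; simp at hs0
  have e1 : ∀ k : Fin 4, (-1) ^ (k : ℕ) * conj (b k.rev) = d k * r := fun k => by
    rw [← hcoeff, hs, coeff_mul_C, num_coeff]
  have e2 : ∀ k : Fin 4, (-1) ^ (k : ℕ) * conj (d k.rev) = -(r * b k) := fun k => by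
    rw [← hcoeff, hs', coeff_neg, coeff_C_mul, num_coeff]
  have hr1 : r * conj r = 1 := by
    obtain ⟨k, hk⟩ : ∃ k, b k ≠ 0 := by
      by_contra! h
      exact hp0 (by simp [num, h])
    have h1 := congrArg conj (e1 k.rev)
    have h2 := e2 k
    rw [Fin.rev_rev] at h1
    simp only [map_mul, map_pow, map_neg, map_one, Complex.conj_conj] at h1
    have h3 : ((-1 : ℂ)) ^ (k : ℕ) * (-1) ^ ((k.rev : Fin 4) : ℕ) = -1 := by
      fin_cases k <;> simp [Fin.rev, pow_succ]
    have h4 : b k * (r * conj r - 1) = 0 := by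
      linear_combination (-1 : ℂ) ^ (k : ℕ) * h1 + conj r * h2 - b k * h3
    rcases mul_eq_zero.1 h4 with h | h
    · exact absurd h hk
    · exact sub_eq_zero.1 h
  obtain ⟨m, hm⟩ := IsAlgClosed.exists_pow_nat_eq r (n := 2) (by norm_num)
  have hmn : Complex.normSq m = 1 := by
    have h1 := congrArg Complex.re hr1
    rw [Complex.mul_conj, ← hm, map_pow, Complex.ofReal_re, Complex.one_re] at h1
    nlinarith [Complex.normSq_nonneg m]
  have hm1 : conj m * r = m := by
    have h : m * conj m = 1 := by rw [Complex.mul_conj, hmn]; simp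
    rw [← hm]; linear_combination m * h
  have hm0 : m ≠ 0 := by rintro rfl; simp at hmn
  have hd : den (fun k => m * b k) = C m * num d := by
    rw [den_smul, hs]
    calc C (conj m) * (num d * C r) = C (conj m * r) * num d := by rw [C_mul]; ring
      _ = _ := by rw [hm1]
  refine ⟨fun k => m * b k, ?_, ?_⟩
  · rw [num_smul, hd]
    have hu : IsUnit (C m : ℂ[X]) := isUnit_C.2 hm0.isUnit
    exact (isCoprime_mul_unit_left hu _ _).2 hpq
  · rw [num_smul, hd, ratMap_C_mul _ _ hm0]

/-- The images of the parametrizations cover exactly the moduli space. -/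
theorem iUnion_lumpChart : ⋃ j, lumpChart j '' lumpDom j = RatTilde 3 := by
  apply Set.Subset.antisymm
  · refine Set.iUnion_subset fun j => ?_
    rintro _ ⟨y, ⟨-, hy⟩, rfl⟩
    exact ratMap_mem hy
  · intro R hR
    obtain ⟨a, ha, rfl⟩ := exists_coeffs hR
    let x : Fin 8 → ℝ := Fin.addCases (m := 4) (n := 4) (fun k => (a k).re) (fun k => (a k).im)
    have hxl : ∀ k : Fin 4, x (Fin.castAdd 4 k) = (a k).re := fun k => Fin.addCases_left k
    have hxr : ∀ k : Fin 4, x (Fin.natAdd 4 k) = (a k).im := fun k => Fin.addCases_right k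
    obtain ⟨j, hj⟩ := Finite.exists_max fun i => |x i|
    have hj0 : x j ≠ 0 := by
      intro h
      have h0 : ∀ i, x i = 0 := fun i => by
        have := hj i
        rw [h, abs_zero] at this
        exact abs_eq_zero.1 (le_antisymm this (abs_nonneg _))
      have : a = 0 := funext fun k => Complex.ext (by rw [← hxl, h0]; rfl) (by rw [← hxr, h0]; rfl)
      exact den_ne_zero ha (by simp [this, den])
    have hco : lumpCoeffs j (fun k => (x j)⁻¹ * x (j.succAbove k)) =
        fun k => (((x j)⁻¹ : ℝ) : ℂ) * a k := by
      have h : j.insertNth (α := fun _ => ℝ) 1 (fun k => (x j)⁻¹ * x (j.succAbove k)) =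
          fun i => (x j)⁻¹ * x i := by
        rw [Fin.insertNth_eq_iff]
        exact ⟨(inv_mul_cancel₀ hj0).symm, rfl⟩
      funext k
      rw [lumpCoeffs, h]
      apply Complex.ext
      · rw [Complex.re_ofReal_mul, ← hxl]; rfl
      · rw [Complex.im_ofReal_mul, ← hxr]; rfl
    have hr : (((x j)⁻¹ : ℝ) : ℂ) ≠ 0 := by exact_mod_cast inv_ne_zero hj0
    refine Set.mem_iUnion.2 ⟨j, fun k => (x j)⁻¹ * x (j.succAbove k), ⟨fun k => ?_, ?_⟩, ?_⟩
    · rw [abs_mul, abs_inv, inv_mul_eq_div, div_lt_iff₀ (abs_pos.2 hj0)]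
      have := hj (j.succAbove k)
      have := abs_pos.2 hj0
      linarith
    · rw [hco, num_smul, den_smul, Complex.conj_ofReal]
      exact (isCoprime_mul_unit_left (isUnit_C.2 hr.isUnit) _ _).2 ha
    · rw [lumpChart, hco, num_smul, den_smul, Complex.conj_ofReal, ratMap_C_mul _ _ hr]

/-- The Riemannian volume of the moduli space of charge three lumps on the real projective
plane, for the `L²` metric. -/
def lumpVolume : ENNReal := atlasVolume lumpDom lumpChart

/-! ### The parametrization by symmetry orbits -/

/-- The `D₂`-symmetric map `(z³ + c z) / (c z² + 1)`. -/
def Rc (c : ℝ) : OnePoint ℂ → OnePoint ℂ :=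
  ratMap (X ^ 3 + C (c : ℂ) * X) (C (c : ℂ) * X ^ 2 + 1)

/-- The basis `(i/2) τ_a` of the Lie algebra of `SU(2)`, with `τ_a` the Pauli matrices. -/
def su2Basis : Fin 3 → Matrix (Fin 2) (Fin 2) ℂ :=
  ![!![0, Complex.I / 2; Complex.I / 2, 0],
    !![0, 1 / 2; -1 / 2, 0],
    !![Complex.I / 2, 0; 0, -Complex.I / 2]]

/-- The element `∑ ξ_a (i/2) τ_a` of the Lie algebra of `SU(2)`. -/
def su2 (ξ : Fin 3 → ℝ) : Matrix (Fin 2) (Fin 2) ℂ := ∑ a, (ξ a : ℂ) • su2Basis a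

/-- The map `z ↦ M(R_c(U z))`, where matrices act by Möbius transformations. -/
def orbitMap (U M : GL (Fin 2) ℂ) (c : ℝ) : OnePoint ℂ → OnePoint ℂ :=
  fun z => M • Rc c (U • z)

/-- The vector fields on the sphere that generate the rotations about the three axes. -/
def rotField (i : Fin 3) (z : ℂ) : ℂ :=
  ![Complex.I / 2 * (1 - z ^ 2), (1 + z ^ 2) / 2, Complex.I * z] i

/-- `A_ii(c) = ∫ |v_i(z)|² |R_c'|² / (1 + |R_c|²)² dA / (1 + |z|²)²`, `v_i` the rotation fields. -/
def metricA (i : Fin 3) (c : ℝ) : ℝ :=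
  ∫ z : ℂ, ‖rotField i z‖ ^ 2 * ‖deriv (affine (Rc c)) z‖ ^ 2 /
    ((1 + ‖affine (Rc c) z‖ ^ 2) ^ 2 * (1 + ‖z‖ ^ 2) ^ 2)

/-- `D_ii(c) = ∫ |v_i(R_c)|² / (1 + |R_c|²)² dA / (1 + |z|²)²`. -/
def metricD (i : Fin 3) (c : ℝ) : ℝ :=
  ∫ z : ℂ, ‖rotField i (affine (Rc c) z)‖ ^ 2 /
    ((1 + ‖affine (Rc c) z‖ ^ 2) ^ 2 * (1 + ‖z‖ ^ 2) ^ 2)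

/-- `F_ii(c) = 2 ∫ Re(v_i(z) R_c' conj(v_i(R_c))) / (1 + |R_c|²)² dA / (1 + |z|²)²`. -/
def metricF (i : Fin 3) (c : ℝ) : ℝ :=
  2 * ∫ z : ℂ, (rotField i z * deriv (affine (Rc c)) z * conj (rotField i (affine (Rc c) z))).re /
    ((1 + ‖affine (Rc c) z‖ ^ 2) ^ 2 * (1 + ‖z‖ ^ 2) ^ 2)

/-- `C(c) = ∫ |∂_c R_c|² / (1 + |R_c|²)² dA / (1 + |z|²)²`. -/
def metricC (c : ℝ) : ℝ :=
  ∫ z : ℂ, ‖deriv (fun s : ℝ => affine (Rc s) z) c‖ ^ 2 /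
    ((1 + ‖affine (Rc c) z‖ ^ 2) ^ 2 * (1 + ‖z‖ ^ 2) ^ 2)

end Lump

end

noncomputable section

namespace Lump

/-! Write `E = |P|² + |Q|²` for the numerator `P` and denominator `Q` with coefficients `a`. A
coordinate deformation of `P/Q` in the direction `b` is `W/Q²` with `W = P_b Q_a - P_a Q_b`, and the
powers of `|Q|` cancel in the metric, whose density is `Re(W conj W') / (E² (1+|z|²)²)`. If `P` and
`Q` are coprime, then `E` is bounded below by a multiple of `(1+|z|²)³`: by compactness on the unit
disc, and by the antipodal symmetry of `E` outside it (`exists_energy_ge`). Since `W` grows at most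
like `|z|⁶`, the integrals converge.

For the volume, Cauchy–Schwarz gives `|W|² ≤ E_b E_a`, so every metric coefficient is at most a
constant times `∫ (1+|z|²)/E`, and by inversion at most a constant times `∫_D 1/E` over the unit
disc `D` (`lintegral_energy_le`). Near noncoprime coefficients this integral may blow up, but only
like an arbitrarily small negative power of the resultant (`exists_lintegral_energy_inv_le`). To see
this, split `1/E = E^(-θ) E^(-(1-θ))`. On `D` a Bézout identity bounds `E` below by a multiple of
`|Res|²`. The integral of `E^(-(1-θ))` stays bounded, because at a common root one of `P`, `Q` has a
simple zero (`eq_zero_of_double_root`), and `|z|^(-2(1-θ))` is integrable in the plane. Hence `√|det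
g|` is at most a constant times `|Res|^(-7θ)`. Along the real or the imaginary part of `a₀` the
resultant is a monic polynomial of degree six up to a unimodular constant, so `|Res|^(-1/12)` has an
integral over a bounded interval that is bounded independently of the other coordinates. Fubini on
the cube, with `θ = 1/84`, gives finite volume.

On the orbits, unitary Möbius transformations are isometries of source and target, so the metric can
be computed at `R_c` itself (`l2Inner_orbitMap`). There the tangent vectors are the rotation fields
at source and target and `∂_c R_c`. The maps `z ↦ -z` and `z ↦ conj z` act on these by signs: the
three axes and `∂_c R_c` carry the four different characters of `ℤ/2 × ℤ/2`. All products vanish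
except the squares and those of the two rotations about the same axis (`l2Inner_symField`). -/

/-! ### The energy polynomial `|P|² + |Q|²` and integrability of the density -/

/-- `|P|² + |Q|²` for the numerator `P` and the denominator `Q` with coefficients `a`. -/
def energy (a : Fin 4 → ℂ) (z : ℂ) : ℝ := ‖(num a).eval z‖ ^ 2 + ‖(den a).eval z‖ ^ 2

lemma energy_nonneg (a : Fin 4 → ℂ) (z : ℂ) : 0 ≤ energy a z := by
  unfold energy; positivity

/-- At a root of `q` both sides are `0`: the default of `affine` at a pole, and division by zero. -/
lemma affine_ratMap (p q : ℂ[X]) (z : ℂ) : affine (ratMap p q) z = p.eval z / q.eval z := by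
  rw [affine, ratMap_coe]
  split_ifs with h
  · simp [h]
  · simp

@[fun_prop]
lemma continuous_energy : Continuous fun x : (Fin 4 → ℂ) × ℂ => energy x.1 x.2 := by
  unfold energy
  simp only [num_eval, den_eval]
  fun_prop

lemma energy_pos {a : Fin 4 → ℂ} (h : IsCoprime (num a) (den a)) (z : ℂ) : 0 < energy a z := by
  have h0 := (isCoprime_iff _ _).1 h z
  rcases (energy_nonneg a z).lt_or_eq with h1 | h1
  · exact h1
  · exfalso
    apply h0
    unfold energy at h1
    constructor <;> rw [← norm_eq_zero] <;> nlinarith [sq_nonneg ‖(num a).eval z‖,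
      sq_nonneg ‖(den a).eval z‖]

/-- The energy is invariant under the antipodal map, up to the weight. -/
lemma energy_antipode (a : Fin 4 → ℂ) {z : ℂ} (hz : z ≠ 0) :
    energy a (-1 / conj z) = energy a z / ‖z‖ ^ 6 := by
  have : ‖z‖ ≠ 0 := norm_ne_zero_iff.2 hz
  rw [energy, num_antipode a hz, den_antipode a hz]
  simp only [map_div₀, map_neg, map_pow, norm_div, norm_neg, norm_pow, RCLike.norm_conj, energy]
  field_simp
  ring

/-- The minimum over the closed unit disc is positive; `energy_antipode` carries the bound to the
exterior, since `(1+|z|²)³` has the same weight `|z|⁶`. -/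
lemma exists_energy_ge {a : Fin 4 → ℂ} (h : IsCoprime (num a) (den a)) :
    ∃ ε > 0, ∀ z, ε * (1 + ‖z‖ ^ 2) ^ 3 ≤ energy a z := by
  obtain ⟨w, -, hw⟩ := (isCompact_closedBall (0 : ℂ) 1).exists_isMinOn ⟨0, by simp⟩
    (f := energy a) (by
      have : Continuous (energy a) :=
        continuous_energy.comp (Continuous.prodMk continuous_const continuous_id)
      exact this.continuousOn)
  have hw' : ∀ z : ℂ, ‖z‖ ≤ 1 → energy a w ≤ energy a z := fun z hz =>
    hw (by simpa using hz)
  have hpos := energy_pos h w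
  -- The `8` is the value of `(1 + |z|²)³` on the unit circle, its maximum over the disc.
  refine ⟨energy a w / 8, by positivity, fun z => ?_⟩
  rcases le_total ‖z‖ 1 with hz | hz
  · have : (1 + ‖z‖ ^ 2) ^ 3 ≤ (1 + 1 ^ 2) ^ 3 := by gcongr
    have := hw' z hz
    nlinarith
  · have hz0 : z ≠ 0 := by rintro rfl; norm_num at hz
    have h1 := hw' (-1 / conj z) (by
      rw [norm_div, norm_neg, norm_one, RCLike.norm_conj]
      exact (div_le_one (by linarith)).2 hz)
    rw [energy_antipode a hz0, le_div_iff₀ (by positivity)] at h1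
    have h2 : (1 + ‖z‖ ^ 2) ^ 3 ≤ (‖z‖ ^ 2 + ‖z‖ ^ 2) ^ 3 := by
      gcongr; nlinarith
    calc energy a w / 8 * (1 + ‖z‖ ^ 2) ^ 3 ≤ energy a w / 8 * (‖z‖ ^ 2 + ‖z‖ ^ 2) ^ 3 := by
          gcongr
      _ = energy a w * ‖z‖ ^ 6 := by ring
      _ ≤ _ := h1

lemma finite_roots_den {a : Fin 4 → ℂ} (h : IsCoprime (num a) (den a)) :
    {z : ℂ | (den a).eval z = 0}.Finite := by
  simpa [IsRoot] using (finite_setOfPred_isRoot (den_ne_zero h))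

lemma ae_den_ne_zero {a : Fin 4 → ℂ} (h : IsCoprime (num a) (den a)) :
    ∀ᵐ z : ℂ, (den a).eval z ≠ 0 := by
  rw [ae_iff]
  simpa using (finite_roots_den h).measure_zero volume

/-- The density of two deformations of the form `W / Q²`. -/
lemma l2Density_eq {a : Fin 4 → ℂ} {u v : ℂ → ℂ} {z w w' : ℂ} (hz : (den a).eval z ≠ 0)
    (hu : u z = w / (den a).eval z ^ 2) (hv : v z = w' / (den a).eval z ^ 2) :
    l2Density (ratMap (num a) (den a)) u v z =
      (w * conj w').re / (energy a z ^ 2 * (1 + ‖z‖ ^ 2) ^ 2) := by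
  set q := (den a).eval z with hq
  have hq0 : ‖q‖ ≠ 0 := norm_ne_zero_iff.2 hz
  -- The factor `|Q|⁻⁴` cancels against `(1 + |P/Q|²)² = E² / |Q|⁴`, so the poles of the map are no
  -- singularities of the density.
  have h1 : u z * conj (v z) = ((1 / ‖q‖ ^ 4 : ℝ) : ℂ) * (w * conj w') := by
    have hc : conj q ≠ 0 := by simpa using hz
    have h2 : ((‖q‖ : ℝ) : ℂ) ^ 2 = q * conj q := by
      rw [Complex.mul_conj, Complex.normSq_eq_norm_sq]; push_cast; rfl
    have h4 : ((‖q‖ : ℝ) : ℂ) ^ 4 = (q * conj q) ^ 2 := by rw [← h2]; ring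
    rw [hu, hv]
    push_cast
    rw [h4, map_div₀, map_pow]
    field_simp
  rw [l2Density, h1, Complex.re_ofReal_mul, affine_ratMap, energy, ← hq, norm_div]
  have h3 : 0 < ‖q‖ ^ 2 := by positivity
  have h4 : ‖eval z (num a)‖ ^ 2 + ‖q‖ ^ 2 ≠ 0 := by positivity
  have h5 : (1 + ‖z‖ ^ 2) ≠ 0 := by positivity
  have h6 : (1 + (‖eval z (num a)‖ / ‖q‖) ^ 2) = (‖eval z (num a)‖ ^ 2 + ‖q‖ ^ 2) / ‖q‖ ^ 2 := by
    field_simp; ring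
  rw [h6]
  field_simp

lemma integrable_weight : Integrable fun z : ℂ => ((1 + ‖z‖ ^ 2) ^ 2)⁻¹ := by
  have := integrable_rpow_neg_one_add_norm_sq (E := ℂ) (μ := volume) (r := 4)
    (by rw [Complex.finrank_real_complex]; norm_num)
  refine this.congr (Filter.Eventually.of_forall fun z => ?_)
  show (1 + ‖z‖ ^ 2) ^ (-(4 : ℝ) / 2) = _
  rw [show -(4 : ℝ) / 2 = -((2 : ℕ) : ℝ) by norm_num, Real.rpow_neg (by positivity),
    Real.rpow_natCast]

/-- Deformations `W / Q²`, where `W` grows at most like `|z|⁶`, have integrable densities. -/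
lemma integrable_l2Density {a : Fin 4 → ℂ} (h : IsCoprime (num a) (den a)) {u v W W' : ℂ → ℂ}
    (hW : Continuous W) (hW' : Continuous W') {K K' : ℝ}
    (hK : ∀ z, ‖W z‖ ≤ K * (1 + ‖z‖ ^ 2) ^ 3) (hK' : ∀ z, ‖W' z‖ ≤ K' * (1 + ‖z‖ ^ 2) ^ 3)
    (hu : ∀ z, (den a).eval z ≠ 0 → u z = W z / (den a).eval z ^ 2)
    (hv : ∀ z, (den a).eval z ≠ 0 → v z = W' z / (den a).eval z ^ 2) :
    Integrable (l2Density (ratMap (num a) (den a)) u v) := by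
  obtain ⟨ε, hε, hle⟩ := exists_energy_ge h
  have hcont : Continuous (energy a) :=
    continuous_energy.comp (Continuous.prodMk continuous_const continuous_id)
  have hpos := energy_pos h
  have heq : (fun z => (W z * conj (W' z)).re / (energy a z ^ 2 * (1 + ‖z‖ ^ 2) ^ 2)) =ᵐ[volume]
      l2Density (ratMap (num a) (den a)) u v := by
    filter_upwards [ae_den_ne_zero h] with z hz
    rw [l2Density_eq hz (hu z hz) (hv z hz)]
  refine Integrable.congr ?_ heq
  refine (integrable_weight.const_mul (K * K' / ε ^ 2)).mono' ?_ (Filter.Eventually.of_forall ?_)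
  · refine Continuous.aestronglyMeasurable (Continuous.div ?_ ?_ fun z => ?_)
    · fun_prop
    · fun_prop
    · have := hpos z
      positivity
  · intro z
    have hp := hpos z
    have h1 : |(W z * conj (W' z)).re| ≤ (K * (1 + ‖z‖ ^ 2) ^ 3) * (K' * (1 + ‖z‖ ^ 2) ^ 3) := by
      refine (Complex.abs_re_le_norm _).trans ?_
      rw [norm_mul, RCLike.norm_conj]
      exact mul_le_mul (hK z) (hK' z) (norm_nonneg _) ((norm_nonneg _).trans (hK z))
    have hKK : 0 ≤ K * K' := by
      have h0 : 0 ≤ K := by simpa using (norm_nonneg _).trans (hK 0)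
      have h0' : 0 ≤ K' := by simpa using (norm_nonneg _).trans (hK' 0)
      positivity
    rw [Real.norm_eq_abs, abs_div, abs_of_nonneg (by positivity :
      0 ≤ energy a z ^ 2 * (1 + ‖z‖ ^ 2) ^ 2), div_le_iff₀ (by positivity)]
    refine h1.trans ?_
    have h2 : (ε * (1 + ‖z‖ ^ 2) ^ 3) ^ 2 ≤ energy a z ^ 2 := by
      gcongr; exact hle z
    calc _ = K * K' / ε ^ 2 * (ε * (1 + ‖z‖ ^ 2) ^ 3) ^ 2 := by field_simp
      _ ≤ K * K' / ε ^ 2 * energy a z ^ 2 := by gcongr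
      _ = _ := by field_simp

/-! ### The coordinate deformations -/

/-- The coefficient vector of the `k`-th coordinate direction of the `j`-th affine chart. -/
def lumpDir (j : Fin 8) (k : Fin 7) : Fin 4 → ℂ :=
  coeffs (Pi.single (j.succAbove k) 1)

lemma coeffs_add_smul (x y : Fin 8 → ℝ) (t : ℝ) :
    coeffs (x + t • y) = coeffs x + (t : ℂ) • coeffs y := by
  funext k
  apply Complex.ext <;> simp [coeffs]

lemma lumpCoeffs_add_single (j : Fin 8) (y : Fin 7 → ℝ) (k : Fin 7) (t : ℝ) :
    lumpCoeffs j (y + t • Pi.single k 1) = lumpCoeffs j y + (t : ℂ) • lumpDir j k := by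
  rw [lumpDir, lumpCoeffs, lumpCoeffs, ← coeffs_add_smul]
  congr 1
  rw [Fin.insertNth_eq_iff]
  constructor
  · simp [(Fin.succAbove_ne j k).symm]
  · funext i
    simp [Fin.removeNth, Pi.single_apply]

lemma num_eval_add_smul (a b : Fin 4 → ℂ) (t : ℝ) (z : ℂ) :
    (num (a + (t : ℂ) • b)).eval z = (num a).eval z + t * (num b).eval z := by
  simp only [num_eval, Pi.add_apply, Pi.smul_apply, smul_eq_mul]; ring

lemma den_eval_add_smul (a b : Fin 4 → ℂ) (t : ℝ) (z : ℂ) :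
    (den (a + (t : ℂ) • b)).eval z = (den a).eval z + t * (den b).eval z := by
  simp only [den_eval, Pi.add_apply, Pi.smul_apply, smul_eq_mul, map_add, map_mul,
    Complex.conj_ofReal]; ring

/-- The numerator `P_b Q_a - P_a Q_b` of the deformation of the map `a` in the direction `b`. -/
def wronski (a b : Fin 4 → ℂ) (z : ℂ) : ℂ :=
  (num b).eval z * (den a).eval z - (num a).eval z * (den b).eval z

/-- The quotient rule. Roots of `Q` are excluded because `affine` takes its default value there;
they form a null set. -/
lemma partialField_lumpChart {j : Fin 8} {y : Fin 7 → ℝ} (k : Fin 7) {z : ℂ}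
    (hz : (den (lumpCoeffs j y)).eval z ≠ 0) :
    partialField (lumpChart j) y k z =
      wronski (lumpCoeffs j y) (lumpDir j k) z / (den (lumpCoeffs j y)).eval z ^ 2 := by
  rw [partialField, lineDeriv]
  have h1 : (fun t : ℝ => affine (lumpChart j (y + t • Pi.single k 1)) z) = fun t : ℝ =>
      ((num (lumpCoeffs j y)).eval z + t * (num (lumpDir j k)).eval z) /
      ((den (lumpCoeffs j y)).eval z + t * (den (lumpDir j k)).eval z) := by
    funext t
    rw [lumpChart, affine_ratMap, lumpCoeffs_add_single, num_eval_add_smul, den_eval_add_smul]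
  rw [h1]
  have hlin : ∀ p q : ℂ, HasDerivAt (fun t : ℝ => p + t * q) q 0 := fun p q => by
    simpa using ((Complex.ofRealCLM.hasDerivAt (x := (0 : ℝ))).mul_const q).const_add p
  have := (hlin ((num (lumpCoeffs j y)).eval z) ((num (lumpDir j k)).eval z)).div
    (hlin ((den (lumpCoeffs j y)).eval z) ((den (lumpDir j k)).eval z)) (by simpa using hz)
  refine this.deriv.trans ?_
  simp [wronski]

lemma energy_le (a : Fin 4 → ℂ) {K : ℝ} (ha : ∀ k, ‖a k‖ ≤ K) (z : ℂ) :
    energy a z ≤ 32 * K ^ 2 * (1 + ‖z‖ ^ 2) ^ 3 := by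
  have hK : 0 ≤ K := (norm_nonneg _).trans (ha 0)
  set r := ‖z‖ with hr
  have hr0 : 0 ≤ r := norm_nonneg z
  have key : ∀ b0 b1 b2 b3 : ℂ, ‖b0‖ ≤ K → ‖b1‖ ≤ K → ‖b2‖ ≤ K → ‖b3‖ ≤ K →
      ‖b0 + b1 * z + b2 * z ^ 2 + b3 * z ^ 3‖ ≤ K * (1 + r + r ^ 2 + r ^ 3) := by
    intro b0 b1 b2 b3 h0 h1 h2 h3
    refine norm_add₄_le.trans ?_
    simp only [norm_mul, norm_pow, ← hr]
    have := mul_le_mul_of_nonneg_right h1 hr0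
    have := mul_le_mul_of_nonneg_right h2 (pow_nonneg hr0 2)
    have := mul_le_mul_of_nonneg_right h3 (pow_nonneg hr0 3)
    linarith
  have h1 : ‖(num a).eval z‖ ≤ K * (1 + r + r ^ 2 + r ^ 3) := by
    rw [num_eval]; exact key _ _ _ _ (ha _) (ha _) (ha _) (ha _)
  have h2 : ‖(den a).eval z‖ ≤ K * (1 + r + r ^ 2 + r ^ 3) := by
    rw [den_eq, num_eval]; exact key _ _ _ _ (by simpa using ha _) (by simpa using ha _)
      (by simpa using ha _) (by simpa using ha _)
  -- The cubic factors as `(1 + r)(1 + r²)`. The constant `16` is generous; two such terms make the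
  -- `32` of the statement.
  have h3 : (1 + r + r ^ 2 + r ^ 3) ^ 2 ≤ 16 * (1 + r ^ 2) ^ 3 := by
    have e : (1 + r + r ^ 2 + r ^ 3) ^ 2 = (1 + r) ^ 2 * (1 + r ^ 2) ^ 2 := by ring
    have : (1 + r) ^ 2 ≤ 2 * (1 + r ^ 2) := by nlinarith [sq_nonneg (1 - r)]
    rw [e]
    calc _ ≤ 2 * (1 + r ^ 2) * (1 + r ^ 2) ^ 2 := by gcongr
      _ ≤ _ := by nlinarith [pow_nonneg (by positivity : 0 ≤ 1 + r ^ 2) 3]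
  have h4 : ‖(num a).eval z‖ ^ 2 ≤ (K * (1 + r + r ^ 2 + r ^ 3)) ^ 2 := by gcongr
  have h5 : ‖(den a).eval z‖ ^ 2 ≤ (K * (1 + r + r ^ 2 + r ^ 3)) ^ 2 := by gcongr
  rw [mul_pow] at h4 h5
  unfold energy
  nlinarith [mul_le_mul_of_nonneg_left h3 (sq_nonneg K)]

lemma norm_lumpDir_le (j : Fin 8) (k : Fin 7) (i : Fin 4) : ‖lumpDir j k i‖ ≤ 2 := by
  refine (Complex.norm_le_abs_re_add_abs_im _).trans ?_
  have h : ∀ i : Fin 8, |(Pi.single (j.succAbove k) (1 : ℝ) : Fin 8 → ℝ) i| ≤ 1 := by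
    intro i
    rw [Pi.single_apply]
    split_ifs <;> simp
  have := h (Fin.castAdd 4 i)
  have := h (Fin.natAdd 4 i)
  simp only [lumpDir, coeffs]
  linarith

/-- Cauchy–Schwarz for `(P_b, Q_b)` and `(Q_a, -P_a)`, whose norms squared are the two energies. It
cancels one of the two powers of `E_a` in the denominator of the density. -/
lemma norm_wronski_sq_le (a b : Fin 4 → ℂ) (z : ℂ) :
    ‖wronski a b z‖ ^ 2 ≤ energy b z * energy a z := by
  have h1 : ‖wronski a b z‖ ≤ ‖(num b).eval z‖ * ‖(den a).eval z‖ +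
      ‖(num a).eval z‖ * ‖(den b).eval z‖ := by
    refine (norm_sub_le _ _).trans ?_
    rw [norm_mul, norm_mul]
  calc _ ≤ (‖(num b).eval z‖ * ‖(den a).eval z‖ + ‖(num a).eval z‖ * ‖(den b).eval z‖) ^ 2 := by
        gcongr
    _ ≤ _ := by
        unfold energy
        nlinarith [sq_nonneg (‖(num b).eval z‖ * ‖(num a).eval z‖ -
          ‖(den a).eval z‖ * ‖(den b).eval z‖)]

@[fun_prop]
lemma continuous_wronski (a b : Fin 4 → ℂ) : Continuous (wronski a b) := by
  unfold wronski; fun_prop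

/-- The constant is `128 = 32 · 2²`, from `energy_le` with coefficient bound `2` for the direction.
-/
lemma norm_wronski_lumpDir_sq_le (a : Fin 4 → ℂ) (j : Fin 8) (k : Fin 7) (z : ℂ) :
    ‖wronski a (lumpDir j k) z‖ ^ 2 ≤ 128 * (1 + ‖z‖ ^ 2) ^ 3 * energy a z := by
  refine (norm_wronski_sq_le _ _ _).trans ?_
  have := energy_le (lumpDir j k) (norm_lumpDir_le j k) z
  have h := energy_nonneg a z
  nlinarith

lemma exists_norm_wronski_le (a : Fin 4 → ℂ) (j : Fin 8) (k : Fin 7) :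
    ∃ K, ∀ z, ‖wronski a (lumpDir j k) z‖ ≤ K * (1 + ‖z‖ ^ 2) ^ 3 := by
  obtain ⟨B, hB⟩ : ∃ B, ∀ k, ‖a k‖ ≤ B := ⟨∑ k, ‖a k‖, fun k =>
    Finset.single_le_sum (f := fun k => ‖a k‖) (fun i _ => norm_nonneg _) (Finset.mem_univ k)⟩
  refine ⟨Real.sqrt (128 * (32 * B ^ 2)), fun z => ?_⟩
  refine le_of_sq_le_sq ?_ (by positivity)
  rw [mul_pow, Real.sq_sqrt (by positivity)]
  have := mul_le_mul_of_nonneg_left (energy_le a hB z)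
    (by positivity : 0 ≤ 128 * (1 + ‖z‖ ^ 2) ^ 3)
  calc _ ≤ _ := norm_wronski_lumpDir_sq_le a j k z
    _ ≤ _ := this
    _ = _ := by ring

/-- The `L²` metric is well defined in the affine charts. -/
theorem integrable_l2Density_lumpChart {j : Fin 8} {y : Fin 7 → ℝ} (hy : y ∈ lumpDom j)
    (k l : Fin 7) : Integrable (l2Density (lumpChart j y) (partialField (lumpChart j) y k)
      (partialField (lumpChart j) y l)) := by
  obtain ⟨K, hK⟩ := exists_norm_wronski_le (lumpCoeffs j y) j k
  obtain ⟨K', hK'⟩ := exists_norm_wronski_le (lumpCoeffs j y) j l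
  exact integrable_l2Density hy.2 (continuous_wronski _ _) (continuous_wronski _ _) hK hK'
    (fun z hz => partialField_lumpChart k hz) (fun z hz => partialField_lumpChart l hz)

/-- The metric coefficients are bounded by the integral of `(1 + |z|²) / (|P|² + |Q|²)`. -/
lemma enorm_l2Gram_le {j : Fin 8} {y : Fin 7 → ℝ} (hy : y ∈ lumpDom j) (k l : Fin 7) :
    ‖l2Gram (lumpChart j) y k l‖ₑ ≤
      ∫⁻ z : ℂ, ENNReal.ofReal (128 * (1 + ‖z‖ ^ 2) / energy (lumpCoeffs j y) z) := by
  refine (enorm_integral_le_lintegral_enorm _).trans (lintegral_mono_ae ?_)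
  filter_upwards [ae_den_ne_zero hy.2] with z hz
  have hp := energy_pos hy.2 z
  rw [lumpChart, l2Density_eq hz (partialField_lumpChart k hz) (partialField_lumpChart l hz),
    ← ofReal_norm]
  refine ENNReal.ofReal_le_ofReal ?_
  have h1 := norm_wronski_lumpDir_sq_le (lumpCoeffs j y) j k z
  have h2 := norm_wronski_lumpDir_sq_le (lumpCoeffs j y) j l z
  set w := wronski (lumpCoeffs j y) (lumpDir j k) z
  set w' := wronski (lumpCoeffs j y) (lumpDir j l) z
  have h3 : |(w * conj w').re| ≤ 128 * (1 + ‖z‖ ^ 2) ^ 3 * energy (lumpCoeffs j y) z := by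
    refine (Complex.abs_re_le_norm _).trans ?_
    rw [norm_mul, RCLike.norm_conj]
    nlinarith [sq_nonneg (‖w‖ - ‖w'‖)]
  rw [Real.norm_eq_abs, abs_div, abs_of_nonneg (by positivity :
    0 ≤ energy (lumpCoeffs j y) z ^ 2 * (1 + ‖z‖ ^ 2) ^ 2), div_le_div_iff₀ (by positivity) hp]
  calc _ ≤ 128 * (1 + ‖z‖ ^ 2) ^ 3 * energy (lumpCoeffs j y) z * energy (lumpCoeffs j y) z := by
        gcongr
    _ = _ := by ring

/-! ### Uniform integrability of negative powers of the energy -/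

lemma ennreal_rpow_neg_le_rpow_neg {x y : ENNReal} {s : ℝ} (hs : 0 ≤ s) (h : x ≤ y) :
    y ^ (-s) ≤ x ^ (-s) := by
  rw [ENNReal.rpow_neg, ENNReal.rpow_neg, ENNReal.inv_le_inv]
  exact ENNReal.rpow_le_rpow h hs

lemma lintegral_enorm_rpow_ball_lt_top {E : Type*} [NormedAddCommGroup E] [NormedSpace ℝ E]
    [FiniteDimensional ℝ E] [MeasurableSpace E] [BorelSpace E] (μ : Measure E)
    [μ.IsAddHaarMeasure] (hd : 1 ≤ Module.finrank ℝ E) {α : ℝ}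
    (hα : α < Module.finrank ℝ E) (r : ℝ) :
    ∫⁻ x in Metric.ball (0 : E) r, ‖x‖ₑ ^ (-α) ∂μ < ⊤ := by
  have : Nontrivial E := Module.nontrivial_of_finrank_pos (R := ℝ) (by omega)
  have h := integrableOn_ball_of_norm_le_rpow (μ := μ) hd (f := fun x : E => ‖x‖ ^ (-α)) (C := 1)
    (r := r) hα (Filter.Eventually.of_forall fun x => by
      rw [one_mul, Real.norm_of_nonneg (by positivity)])
    (by
      have : Measurable fun x : E => ‖x‖ ^ (-α) := by fun_prop
      exact this.aestronglyMeasurable)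
  have h2 := h.2
  rw [HasFiniteIntegral] at h2
  refine lt_of_le_of_lt (lintegral_mono_ae ?_) h2
  -- The extended power may be `⊤` at the origin where the real power is finite; elsewhere they
  -- agree.
  have h0 : ∀ᵐ x ∂(μ.restrict (Metric.ball (0 : E) r)), x ≠ 0 := by
    refine ae_restrict_of_ae ?_
    rw [ae_iff]
    simp
  filter_upwards [h0] with x hx
  rw [← ofReal_norm, ← ofReal_norm, ENNReal.ofReal_rpow_of_pos (norm_pos_iff.2 hx),
    Real.norm_of_nonneg (by positivity)]

/-- Common roots of numerator and denominator are simple. -/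
lemma eq_zero_of_double_root {a : Fin 4 → ℂ} {z : ℂ} (h1 : (num a).eval z = 0)
    (h2 : a 1 + a 2 * (z + z) + a 3 * (z ^ 2 + z * z + z ^ 2) = 0) (h3 : (den a).eval z = 0)
    (h4 : -conj (a 2) + conj (a 1) * (z + z) + -conj (a 0) * (z ^ 2 + z * z + z ^ 2) = 0) :
    a = 0 := by
  rw [num_eval] at h1
  rw [den_eval] at h3
  replace h3 := congrArg conj h3
  replace h4 := congrArg conj h4
  simp only [map_add, map_sub, map_mul, map_neg, map_pow, Complex.conj_conj, map_zero] at h3 h4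
  have hD : 1 + z * conj z ≠ 0 := by
    rw [Complex.mul_conj]
    have := Complex.normSq_nonneg z
    norm_cast
    positivity
  set u := conj z
  obtain ⟨b, hb⟩ : ∃ b, b = a 2 + 2 * z * a 3 := ⟨_, rfl⟩
  have e2 : a 2 = b - 2 * z * a 3 := by rw [hb]; ring
  have e1 : a 1 = z ^ 2 * a 3 - 2 * z * b := by rw [e2] at h2; linear_combination h2
  have e0 : a 0 = z ^ 2 * b := by rw [e1, e2] at h1; linear_combination h1
  rw [e2, e1, e0] at h3 h4
  have h5 : a 3 = u * b := by
    have : (1 + z * u) ^ 2 * (a 3 - u * b) = 0 := by linear_combination h3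
    exact sub_eq_zero.1 ((mul_eq_zero.1 this).resolve_left (pow_ne_zero 2 hD))
  rw [h5] at h4
  have h6 : b = 0 := by
    have : (1 + z * u) ^ 2 * b = 0 := by linear_combination -h4
    exact (mul_eq_zero.1 this).resolve_left (pow_ne_zero 2 hD)
  rw [h6] at e0 e1 e2 h5
  rw [mul_zero] at h5
  funext k
  fin_cases k <;> simp [e0, e1, e2, h5]

/-- A family of cubics with a simple zero at `z₀` has locally uniformly integrable negative
powers. -/
lemma exists_nhds_lintegral_le_of_simple_root {s : ℝ} (hs0 : 0 ≤ s) (hs : s < 1)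
    {f : (Fin 4 → ℂ) → Fin 4 → ℂ} (hf : Continuous f)
    (hle : ∀ a z, ‖(num (f a)).eval z‖ ^ 2 ≤ energy a z) {a₀ : Fin 4 → ℂ} {z₀ : ℂ}
    (h : f a₀ 1 + f a₀ 2 * (z₀ + z₀) + f a₀ 3 * (z₀ ^ 2 + z₀ * z₀ + z₀ ^ 2) ≠ 0) :
    ∃ N ∈ nhds (a₀, z₀), ∃ C : ENNReal, C ≠ ⊤ ∧ ∀ a,
      ∫⁻ z in {z | (a, z) ∈ N}, ENNReal.ofReal (energy a z) ^ (-s) ≤ C := by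
  -- The divided difference `(p(z) - p(w)) / (z - w)` of the cubic `p` with coefficients `f a`, a
  -- polynomial in `z` and `w`. Its value on the diagonal is the derivative, so it stays away from
  -- `0` near a simple zero.
  let G : (Fin 4 → ℂ) × ℂ × ℂ → ℂ := fun x =>
    f x.1 1 + f x.1 2 * (x.2.1 + x.2.2) + f x.1 3 * (x.2.1 ^ 2 + x.2.1 * x.2.2 + x.2.2 ^ 2)
  have hG : Continuous G := by fun_prop
  have hG0 : 0 < ‖G (a₀, z₀, z₀)‖ := norm_pos_iff.2 h
  set c := ‖G (a₀, z₀, z₀)‖ / 2 with hc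
  have hc0 : 0 < c := by positivity
  have hev : ∀ᶠ x in nhds (a₀, z₀, z₀), c < ‖G x‖ :=
    (hG.norm.tendsto _).eventually (lt_mem_nhds (by rw [hc]; linarith))
  obtain ⟨δ, hδ, hball⟩ := Metric.eventually_nhds_iff.1 hev
  have hquot : ∀ a ∈ Metric.ball a₀ δ, ∀ z ∈ Metric.closedBall z₀ (δ / 2),
      ∀ w ∈ Metric.closedBall z₀ (δ / 2),
      c * ‖z - w‖ ≤ ‖(num (f a)).eval z - (num (f a)).eval w‖ := by
    intro a ha z hz w hw
    have h1 := hball (y := (a, z, w)) (by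
      rw [Prod.dist_eq, Prod.dist_eq]
      simp only [Metric.mem_ball, Metric.mem_closedBall] at ha hz hw
      refine max_lt ha (max_lt ?_ ?_) <;> simp only <;> linarith)
    have h2 : (num (f a)).eval z - (num (f a)).eval w = G (a, z, w) * (z - w) := by
      rw [num_eval, num_eval]; simp only [G]; ring
    rw [h2, norm_mul]
    gcongr
  refine ⟨Metric.ball a₀ δ ×ˢ Metric.closedBall z₀ (δ / 2),
    prod_mem_nhds (Metric.ball_mem_nhds _ hδ) (Metric.closedBall_mem_nhds _ (by positivity)),
    ∫⁻ w in Metric.ball (0 : ℂ) (2 * δ), ENNReal.ofReal (c / 2) ^ (-(2 * s)) * ‖w‖ₑ ^ (-(2 * s)),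
    ?_, ?_⟩
  · rw [lintegral_const_mul' _ _ (by simp [ENNReal.rpow_eq_top_iff, hc0])]
    refine ENNReal.mul_ne_top (by simp [ENNReal.rpow_eq_top_iff, hc0]) ?_
    refine (lintegral_enorm_rpow_ball_lt_top volume ?_ ?_ _).ne <;>
      rw [Complex.finrank_real_complex]
    · norm_num
    · push_cast; linarith
  · intro a
    by_cases ha : a ∈ Metric.ball a₀ δ
    swap
    · simp [Set.mem_prod, ha]
    have hset : {z | (a, z) ∈ Metric.ball a₀ δ ×ˢ Metric.closedBall z₀ (δ / 2)} =
        Metric.closedBall z₀ (δ / 2) := by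
      ext z; simp only [Set.mem_ofPred_eq, Set.mem_prod, ha, true_and]
    rw [hset]
    -- A minimizer `w` of `|p|` replaces the moving root: `2|p(z)| ≥ |p(z)| + |p(w)| ≥ |p(z) - p(w)|
    -- ≥ c|z - w|`, so no root has to be followed as `a` varies.
    obtain ⟨w, hw, hmin⟩ := (isCompact_closedBall z₀ (δ / 2)).exists_isMinOn
      ⟨z₀, Metric.mem_closedBall_self (by positivity)⟩
      (f := fun z => ‖(num (f a)).eval z‖) (by fun_prop)
    have hpt : ∀ z ∈ Metric.closedBall z₀ (δ / 2), ENNReal.ofReal (energy a z) ^ (-s) ≤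
        ENNReal.ofReal (c / 2) ^ (-(2 * s)) * ‖z - w‖ₑ ^ (-(2 * s)) := by
      intro z hz
      have h1 := hquot a ha z hz w hw
      have h2 : ‖(num (f a)).eval w‖ ≤ ‖(num (f a)).eval z‖ := hmin hz
      have h3 := norm_sub_le ((num (f a)).eval z) ((num (f a)).eval w)
      have h4 : c / 2 * ‖z - w‖ ≤ ‖(num (f a)).eval z‖ := by linarith
      have h5 : (c / 2 * ‖z - w‖) ^ 2 ≤ energy a z :=
        (pow_le_pow_left₀ (by positivity) h4 2).trans (hle a z)
      rw [← ENNReal.mul_rpow_of_ne_top (by simp) (by simp), ← mul_neg, ENNReal.rpow_mul]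
      refine ennreal_rpow_neg_le_rpow_neg hs0 ?_
      rw [← ofReal_norm, ← ENNReal.ofReal_mul (by positivity), ENNReal.rpow_ofNat,
        ← ENNReal.ofReal_pow (by positivity)]
      exact ENNReal.ofReal_le_ofReal h5
    calc _ ≤ ∫⁻ z in Metric.closedBall z₀ (δ / 2),
          ENNReal.ofReal (c / 2) ^ (-(2 * s)) * ‖z - w‖ₑ ^ (-(2 * s)) :=
          setLIntegral_mono' Metric.isClosed_closedBall.measurableSet hpt
      _ ≤ ∫⁻ z, (Metric.ball (0 : ℂ) (2 * δ)).indicator (fun w =>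
          ENNReal.ofReal (c / 2) ^ (-(2 * s)) * ‖w‖ₑ ^ (-(2 * s))) (z - w) := by
          rw [← lintegral_indicator Metric.isClosed_closedBall.measurableSet]
          refine lintegral_mono fun z => ?_
          by_cases hz : z ∈ Metric.closedBall z₀ (δ / 2)
          · rw [Set.indicator_of_mem hz, Set.indicator_of_mem]
            rw [mem_ball_zero_iff, ← dist_eq_norm]
            have := dist_triangle_right z w z₀
            rw [Metric.mem_closedBall] at hz hw
            linarith
          · rw [Set.indicator_of_notMem hz]; exact zero_le
      _ = _ := by
          rw [lintegral_sub_right_eq_self (fun z => (Metric.ball (0 : ℂ) (2 * δ)).indicator (fun w =>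
            ENNReal.ofReal (c / 2) ^ (-(2 * s)) * ‖w‖ₑ ^ (-(2 * s))) z) w,
            lintegral_indicator Metric.isOpen_ball.measurableSet]

/-- Where the energy is positive, it is bounded below nearby. Where it vanishes,
`eq_zero_of_double_root` makes the zero of `P` or that of `Q` simple, and the chosen one alone
controls the energy. -/
lemma exists_nhds_lintegral_le {s : ℝ} (hs0 : 0 ≤ s) (hs : s < 1) {a₀ : Fin 4 → ℂ}
    (h : a₀ ≠ 0) (z₀ : ℂ) :
    ∃ N ∈ nhds (a₀, z₀), ∃ C : ENNReal, C ≠ ⊤ ∧ ∀ a,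
      ∫⁻ z in {z | (a, z) ∈ N}, ENNReal.ofReal (energy a z) ^ (-s) ≤ C := by
  by_cases hpos : 0 < energy a₀ z₀
  · have hev : ∀ᶠ x in nhds (a₀, z₀), energy a₀ z₀ / 2 < energy x.1 x.2 :=
      (continuous_energy.tendsto (a₀, z₀)).eventually (lt_mem_nhds (by simp only; linarith))
    refine ⟨{x | energy a₀ z₀ / 2 < energy x.1 x.2} ∩ Set.univ ×ˢ Metric.ball z₀ 1,
      Filter.inter_mem hev (prod_mem_nhds Filter.univ_mem (Metric.ball_mem_nhds _ one_pos)),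
      ENNReal.ofReal (energy a₀ z₀ / 2) ^ (-s) * volume (Metric.ball z₀ 1), ?_, fun a => ?_⟩
    · refine ENNReal.mul_ne_top ?_ measure_ball_lt_top.ne
      simp [ENNReal.rpow_eq_top_iff, hpos]
    · have hcont : Continuous (energy a) :=
        continuous_energy.comp (Continuous.prodMk continuous_const continuous_id)
      have hmeas : MeasurableSet {z | (a, z) ∈ {x : (Fin 4 → ℂ) × ℂ | energy a₀ z₀ / 2 <
          energy x.1 x.2} ∩ Set.univ ×ˢ Metric.ball z₀ 1} := by
        have : IsOpen {z | energy a₀ z₀ / 2 < energy a z} := isOpen_lt continuous_const hcont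
        convert (this.inter (Metric.isOpen_ball (x := z₀) (ε := 1))).measurableSet using 1
        ext z; simp
      calc _ ≤ ∫⁻ z in {z | (a, z) ∈ {x : (Fin 4 → ℂ) × ℂ | energy a₀ z₀ / 2 <
          energy x.1 x.2} ∩ Set.univ ×ˢ Metric.ball z₀ 1},
            ENNReal.ofReal (energy a₀ z₀ / 2) ^ (-s) := by
            refine setLIntegral_mono' hmeas fun z hz => ?_
            refine ennreal_rpow_neg_le_rpow_neg hs0 (ENNReal.ofReal_le_ofReal ?_)
            exact (show energy a₀ z₀ / 2 < energy a z from hz.1).le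
        _ ≤ _ := by
            rw [setLIntegral_const]
            gcongr
            intro z hz
            exact hz.2.2
  · have h0 : energy a₀ z₀ = 0 := le_antisymm (not_lt.1 hpos) (energy_nonneg _ _)
    have hn : (num a₀).eval z₀ = 0 := by
      unfold energy at h0
      rw [← norm_eq_zero]
      nlinarith [sq_nonneg ‖(num a₀).eval z₀‖, sq_nonneg ‖(den a₀).eval z₀‖]
    have hd : (den a₀).eval z₀ = 0 := by
      unfold energy at h0
      rw [← norm_eq_zero]
      nlinarith [sq_nonneg ‖(num a₀).eval z₀‖, sq_nonneg ‖(den a₀).eval z₀‖]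
    by_cases h1 : a₀ 1 + a₀ 2 * (z₀ + z₀) + a₀ 3 * (z₀ ^ 2 + z₀ * z₀ + z₀ ^ 2) = 0
    · have h2 : -conj (a₀ 2) + conj (a₀ 1) * (z₀ + z₀) +
          -conj (a₀ 0) * (z₀ ^ 2 + z₀ * z₀ + z₀ ^ 2) ≠ 0 := fun h2 =>
        h (eq_zero_of_double_root hn h1 hd h2)
      refine exists_nhds_lintegral_le_of_simple_root hs0 hs
        (f := fun a => ![conj (a 3), -conj (a 2), conj (a 1), -conj (a 0)]) ?_ ?_ h2
      · refine continuous_pi fun k => ?_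
        fin_cases k <;> simp <;> fun_prop
      · intro a z
        rw [← den_eq, energy]
        nlinarith [sq_nonneg ‖(num a).eval z‖]
    · refine exists_nhds_lintegral_le_of_simple_root hs0 hs (f := id) continuous_id ?_ h1
      intro a z
      rw [energy, id]
      nlinarith [sq_nonneg ‖(den a).eval z‖]

/-- Negative powers of the energy, of exponent less than one, are integrable over the unit disc,
uniformly on compact sets of nonzero coefficients. -/
lemma exists_lintegral_energy_rpow_le {s : ℝ} (hs0 : 0 ≤ s) (hs : s < 1)
    {K : Set (Fin 4 → ℂ)} (hK : IsCompact K) (h0 : 0 ∉ K) :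
    ∃ C : ENNReal, C ≠ ⊤ ∧ ∀ a ∈ K,
      ∫⁻ z in Metric.closedBall (0 : ℂ) 1, ENNReal.ofReal (energy a z) ^ (-s) ≤ C := by
  have key : ∃ C : ENNReal, C ≠ ⊤ ∧ ∀ a,
      ∫⁻ z in {z | (a, z) ∈ K ×ˢ Metric.closedBall (0 : ℂ) 1},
        ENNReal.ofReal (energy a z) ^ (-s) ≤ C := by
    -- Having sections with bounded integrals passes to subsets and to finite unions, so local
    -- bounds suffice on a compact set.
    refine (hK.prod (isCompact_closedBall (0 : ℂ) 1)).induction_on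
      (p := fun S => ∃ C : ENNReal, C ≠ ⊤ ∧ ∀ a,
        ∫⁻ z in {z | (a, z) ∈ S}, ENNReal.ofReal (energy a z) ^ (-s) ≤ C) ?_ ?_ ?_ ?_
    · exact ⟨0, by simp, fun a => by simp⟩
    · rintro S T hST ⟨C, hC, h⟩
      exact ⟨C, hC, fun a => le_trans
        (lintegral_mono_set (s := {z | (a, z) ∈ S}) (t := {z | (a, z) ∈ T}) fun z hz => hST hz) (h a)⟩
    · rintro S T ⟨C, hC, h⟩ ⟨C', hC', h'⟩
      refine ⟨C + C', ENNReal.add_ne_top.2 ⟨hC, hC'⟩, fun a => ?_⟩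
      refine le_trans ?_ (add_le_add (h a) (h' a))
      exact lintegral_union_le _ {z | (a, z) ∈ S} {z | (a, z) ∈ T}
    · rintro ⟨a, z⟩ ⟨ha, -⟩
      obtain ⟨N, hN, h⟩ := exists_nhds_lintegral_le hs0 hs (a₀ := a)
        (fun h => h0 (h ▸ ha)) z
      exact ⟨N, mem_nhdsWithin_of_mem_nhds hN, h⟩
  obtain ⟨C, hC, h⟩ := key
  refine ⟨C, hC, fun a ha => ?_⟩
  refine le_trans (lintegral_mono_set fun z hz => ?_) (h a)
  exact ⟨ha, hz⟩

/-! ### Möbius changes of variables -/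

section Moebius

variable {α β γ δ : ℂ}

lemma hasDerivAt_moebius (h : α * δ - β * γ = 1) {z : ℂ} (hz : γ * z + δ ≠ 0) :
    HasDerivAt (fun z => (α * z + β) / (γ * z + δ)) (1 / (γ * z + δ) ^ 2) z := by
  have h1 : ∀ p q : ℂ, HasDerivAt (fun z : ℂ => p * z + q) p z := fun p q => by
    simpa using ((hasDerivAt_id z).const_mul p).add_const q
  refine ((h1 α β).div (h1 γ δ) hz).congr_deriv ?_
  congr 1
  linear_combination h

lemma injOn_moebius (h : α * δ - β * γ = 1) :
    Set.InjOn (fun z => (α * z + β) / (γ * z + δ)) {z | γ * z + δ ≠ 0} := by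
  intro z hz w hw hzw
  simp only [Set.mem_ofPred_eq] at hz hw
  rw [div_eq_div_iff hz hw] at hzw
  linear_combination hzw - (z - w) * h

lemma image_moebius (h : α * δ - β * γ = 1) :
    (fun z => (α * z + β) / (γ * z + δ)) '' {z | γ * z + δ ≠ 0} = {w | -γ * w + α ≠ 0} := by
  ext w
  constructor
  · rintro ⟨z, hz, rfl⟩
    simp only [Set.mem_ofPred_eq] at hz ⊢
    have : -γ * ((α * z + β) / (γ * z + δ)) + α = 1 / (γ * z + δ) := by
      field_simp
      linear_combination h
    rw [this]
    exact one_div_ne_zero hz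
  · intro hw
    simp only [Set.mem_ofPred_eq] at hw
    obtain ⟨e, he⟩ : ∃ e, e = -γ * w + α := ⟨_, rfl⟩
    rw [← he] at hw
    have h1 : γ * ((δ * w - β) / e) + δ = 1 / e := by
      field_simp
      linear_combination h + δ * he
    refine ⟨(δ * w - β) / e, ?_, ?_⟩
    · simp only [Set.mem_ofPred_eq, h1]
      exact one_div_ne_zero hw
    · simp only [h1]
      field_simp
      linear_combination w * h + β * he

lemma ae_linear_ne_zero (h : γ ≠ 0 ∨ δ ≠ 0) : ∀ᵐ z : ℂ, γ * z + δ ≠ 0 := by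
  rw [ae_iff]
  simp only [ne_eq, not_not]
  refine Set.Finite.measure_zero (Set.Subsingleton.finite ?_) _
  intro z hz w hw
  simp only [Set.mem_ofPred_eq] at hz hw
  by_cases hγ : γ = 0
  · subst hγ
    simp_all
  · exact mul_left_cancel₀ hγ (by linear_combination hz - hw)

lemma ae_moebius_den_ne_zero (h : α * δ - β * γ = 1) : ∀ᵐ z : ℂ, γ * z + δ ≠ 0 := by
  refine ae_linear_ne_zero ?_
  by_contra! hc
  simp [hc.1, hc.2] at h

lemma ae_moebius_inv_den_ne_zero (h : α * δ - β * γ = 1) : ∀ᵐ z : ℂ, -γ * z + α ≠ 0 := by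
  refine ae_linear_ne_zero ?_
  by_contra! hc
  simp_all

lemma restrict_of_ae {p : ℂ → Prop} (h : ∀ᵐ z : ℂ, p z) :
    (volume : Measure ℂ).restrict {z | p z} = volume := by
  rw [Measure.restrict_congr_set (Filter.eventuallyEq_univ.2 h), Measure.restrict_univ]

/-- The derivative of a Möbius transformation, as a real linear map. -/
def moebiusFDeriv (γ δ z : ℂ) : ℂ →L[ℝ] ℂ :=
  (ContinuousLinearMap.toSpanSingleton ℂ (1 / (γ * z + δ) ^ 2)).restrictScalars ℝ

/-- Multiplication by `w` on `ℂ` has real determinant `|w|²`. -/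
lemma det_moebiusFDeriv (γ δ z : ℂ) : |(moebiusFDeriv γ δ z).det| = 1 / ‖γ * z + δ‖ ^ 4 := by
  simp [moebiusFDeriv, ContinuousLinearMap.det, LinearMap.det_restrictScalars,
    Algebra.norm_complex_eq, Complex.normSq_eq_norm_sq, ← pow_mul]

lemma measurableSet_moebius_den (γ δ : ℂ) : MeasurableSet {z : ℂ | γ * z + δ ≠ 0} :=
  (isOpen_ne_fun (by fun_prop) (by fun_prop)).measurableSet

lemma hasFDerivWithinAt_moebius (h : α * δ - β * γ = 1) (z : ℂ) (hz : z ∈ {z | γ * z + δ ≠ 0}) :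
    HasFDerivWithinAt (fun z => (α * z + β) / (γ * z + δ)) (moebiusFDeriv γ δ z)
      {z | γ * z + δ ≠ 0} z :=
  ((hasDerivAt_moebius h hz).hasFDerivAt.restrictScalars ℝ).hasFDerivWithinAt

/-- The transformation is injective off its pole, and its image omits only the pole of its inverse,
so both domains have full measure. -/
lemma lintegral_moebius (h : α * δ - β * γ = 1) (g : ℂ → ENNReal) :
    ∫⁻ w, g w = ∫⁻ z, ENNReal.ofReal (1 / ‖γ * z + δ‖ ^ 4) * g ((α * z + β) / (γ * z + δ)) := by
  have := lintegral_image_eq_lintegral_abs_det_fderiv_mul volume (measurableSet_moebius_den γ δ)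
    (hasFDerivWithinAt_moebius h) (injOn_moebius h) g
  rw [image_moebius h, restrict_of_ae (ae_moebius_inv_den_ne_zero h),
    restrict_of_ae (ae_moebius_den_ne_zero h)] at this
  simpa only [det_moebiusFDeriv] using this

lemma integral_moebius (h : α * δ - β * γ = 1) (g : ℂ → ℝ) :
    ∫ w, g w = ∫ z, 1 / ‖γ * z + δ‖ ^ 4 * g ((α * z + β) / (γ * z + δ)) := by
  have := integral_image_eq_integral_abs_det_fderiv_smul volume (measurableSet_moebius_den γ δ)
    (hasFDerivWithinAt_moebius h) (injOn_moebius h) g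
  rw [image_moebius h, restrict_of_ae (ae_moebius_inv_den_ne_zero h),
    restrict_of_ae (ae_moebius_den_ne_zero h)] at this
  simpa only [det_moebiusFDeriv, smul_eq_mul] using this

end Moebius

/-- Inversion reduces the integral of `(1 + |z|²) / (|P|² + |Q|²)` to the unit disc. -/
lemma lintegral_energy_le (a : Fin 4 → ℂ) :
    ∫⁻ z : ℂ, ENNReal.ofReal (128 * (1 + ‖z‖ ^ 2) / energy a z) ≤
      512 * ∫⁻ z in Metric.closedBall (0 : ℂ) 1, (ENNReal.ofReal (energy a z))⁻¹ := by
  set D := Metric.closedBall (0 : ℂ) 1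
  have hD : MeasurableSet D := Metric.isClosed_closedBall.measurableSet
  set F : ℂ → ENNReal := fun z => ENNReal.ofReal (128 * (1 + ‖z‖ ^ 2) / energy a z) with hF
  have hdisc : ∫⁻ z in D, F z ≤ 256 * ∫⁻ z in D, (ENNReal.ofReal (energy a z))⁻¹ := by
    rw [← lintegral_const_mul' _ _ (by simp)]
    refine setLIntegral_mono' hD fun z hz => ?_
    have hz1 : ‖z‖ ≤ 1 := by simpa [D] using hz
    rcases (energy_nonneg a z).eq_or_lt with h | h
    · simp [hF, ← h]
    · rw [hF, ← ENNReal.ofReal_inv_of_pos h,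
        show (256 : ENNReal) = ENNReal.ofReal 256 by simp, ← ENNReal.ofReal_mul (by norm_num),
        ← div_eq_mul_inv]
      refine ENNReal.ofReal_le_ofReal (div_le_div_of_nonneg_right ?_ h.le)
      nlinarith [norm_nonneg z]
  -- The antipodal map, here `z ↦ -1/z` combined with conjugation, takes the exterior into the disc.
  -- It preserves `F dA`: the weights are `|z|⁶` from the energy, `|z|⁻²` from `1 + |z|²` and
  -- `|z|⁻⁴` from the Jacobian.
  have hext : ∫⁻ z in Dᶜ, F z ≤ ∫⁻ z in D, F z := by
    rw [← lintegral_indicator hD.compl, ← lintegral_indicator hD,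
      lintegral_moebius (α := 0) (β := -1) (γ := 1) (δ := 0) (by norm_num)]
    have hconj : MeasurePreserving (fun z : ℂ => conj z) :=
      Complex.conjLIE.measurePreserving
    rw [← hconj.lintegral_comp_emb Complex.conjLIE.toHomeomorph.measurableEmbedding
      (D.indicator F)]
    refine lintegral_mono_ae ?_
    filter_upwards [ae_linear_ne_zero (γ := 1) (δ := 0) (by simp)] with z hz
    simp only [one_mul, add_zero, zero_mul, zero_add] at hz ⊢
    have hc : conj z ≠ 0 := by simpa using hz
    have hn : 0 < ‖z‖ := norm_pos_iff.2 hz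
    by_cases hm : -1 / z ∈ Dᶜ
    · have hm' : conj z ∈ D := by
        simp only [D, Set.mem_compl_iff, mem_closedBall_zero_iff, norm_div, norm_neg, norm_one,
          not_le, RCLike.norm_conj] at hm ⊢
        rw [lt_div_iff₀ hn] at hm
        linarith
      rw [Set.indicator_of_mem hm, Set.indicator_of_mem hm', hF]
      simp only
      rw [← ENNReal.ofReal_mul (by positivity)]
      have := energy_antipode a hc
      rw [Complex.conj_conj] at this
      rw [this, RCLike.norm_conj, norm_div, norm_neg, norm_one]
      refine ENNReal.ofReal_le_ofReal (le_of_eq ?_)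
      rcases eq_or_ne (energy a (conj z)) 0 with h | h
      · simp [h]
      · field_simp
        ring
    · rw [Set.indicator_of_notMem hm, mul_zero]
      exact zero_le
  rw [← lintegral_add_compl F hD]
  calc _ ≤ (∫⁻ z in D, F z) + ∫⁻ z in D, F z := by gcongr
    _ ≤ (256 * ∫⁻ z in D, (ENNReal.ofReal (energy a z))⁻¹) +
        256 * ∫⁻ z in D, (ENNReal.ofReal (energy a z))⁻¹ := add_le_add hdisc hdisc
    _ = _ := by rw [← add_mul]; norm_num

/-! ### The resultant of numerator and denominator -/

/-- The Sylvester matrix of numerator and denominator. -/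
def sylv (a : Fin 4 → ℂ) : Matrix (Fin 6) (Fin 6) ℂ :=
  !![a 0, a 1, a 2, a 3, 0, 0;
     0, a 0, a 1, a 2, a 3, 0;
     0, 0, a 0, a 1, a 2, a 3;
     conj (a 3), -conj (a 2), conj (a 1), -conj (a 0), 0, 0;
     0, conj (a 3), -conj (a 2), conj (a 1), -conj (a 0), 0;
     0, 0, conj (a 3), -conj (a 2), conj (a 1), -conj (a 0)]

/-- The rows of `sylv a` are the coefficients of `z^i P` and `z^i Q`. With the adjugate this becomes
a Bézout identity for the resultant. -/
lemma sylv_mulVec (a : Fin 4 → ℂ) (z : ℂ) :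
    (sylv a).mulVec ![1, z, z ^ 2, z ^ 3, z ^ 4, z ^ 5] =
      ![(num a).eval z, z * (num a).eval z, z ^ 2 * (num a).eval z,
        (den a).eval z, z * (den a).eval z, z ^ 2 * (den a).eval z] := by
  rw [num_eval, den_eval]
  funext i
  fin_cases i <;> simp [sylv, Matrix.mulVec, dotProduct, Fin.sum_univ_six] <;> ring

lemma continuous_sylv : Continuous sylv := by
  refine continuous_matrix fun i k => ?_
  fin_cases i <;> fin_cases k <;> simp [sylv] <;> fun_prop

/-- On the unit disc the energy is bounded below by the square of the resultant. -/
lemma exists_norm_det_sylv_sq_le {K : Set (Fin 4 → ℂ)} (hK : IsCompact K) :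
    ∃ B : ℝ, 0 < B ∧ ∀ a ∈ K, ∀ z ∈ Metric.closedBall (0 : ℂ) 1,
      ‖(sylv a).det‖ ^ 2 ≤ B * energy a z := by
  have hcont : Continuous fun a => ∑ i, ‖(sylv a).adjugate 0 i‖ := by
    have : Continuous fun a => (sylv a).adjugate := continuous_sylv.matrix_adjugate
    have h : ∀ i, Continuous fun a => (sylv a).adjugate 0 i := fun i => this.matrix_elem 0 i
    fun_prop
  obtain ⟨B, hB⟩ := (hK.image hcont).bddAbove
  refine ⟨2 * (|B| + 1) ^ 2, by positivity, fun a ha z hz => ?_⟩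
  have hB' : ∑ i, ‖(sylv a).adjugate 0 i‖ ≤ |B| + 1 :=
    (hB (Set.mem_image_of_mem _ ha)).trans ((le_abs_self B).trans (by linarith))
  have hz1 : ‖z‖ ≤ 1 := by simpa using hz
  set p := ‖(num a).eval z‖
  set q := ‖(den a).eval z‖
  have hp : 0 ≤ p := norm_nonneg _
  have hq : 0 ≤ q := norm_nonneg _
  -- Entry `0` of `adj(S) S v = det(S) v`, where the vector of powers `v` has `v₀ = 1`. It writes
  -- the resultant as a combination of `P` and `Q` whose coefficients are bounded for `a ∈ K` and
  -- `|z| ≤ 1`.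
  have h1 : (sylv a).det = ∑ i, (sylv a).adjugate 0 i *
      ![(num a).eval z, z * (num a).eval z, z ^ 2 * (num a).eval z,
        (den a).eval z, z * (den a).eval z, z ^ 2 * (den a).eval z] i := by
    have := congrArg (fun v => ((sylv a).adjugate.mulVec v) 0) (sylv_mulVec a z)
    simp only [Matrix.mulVec_mulVec, Matrix.adjugate_mul, Matrix.smul_mulVec,
      Matrix.one_mulVec] at this
    simpa [Matrix.mulVec, dotProduct] using this
  have hz2 : ‖z‖ ^ 2 ≤ 1 := pow_le_one₀ (norm_nonneg _) hz1
  have h2 : ∀ i, ‖(![(num a).eval z, z * (num a).eval z, z ^ 2 * (num a).eval z,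
        (den a).eval z, z * (den a).eval z, z ^ 2 * (den a).eval z] : Fin 6 → ℂ) i‖ ≤ p + q := by
    have e : ∀ r s : ℝ, 0 ≤ r → s ≤ 1 → s * r ≤ r := fun r s hr hs => by nlinarith
    have := e p _ hp hz1
    have := e q _ hq hz1
    have := e p _ hp hz2
    have := e q _ hq hz2
    intro i
    fin_cases i <;> simp [norm_pow] <;> linarith
  have h3 : ‖(sylv a).det‖ ≤ (|B| + 1) * (p + q) := by
    rw [h1]
    calc _ ≤ ∑ i, ‖(sylv a).adjugate 0 i‖ * (p + q) := by
          refine norm_sum_le_of_le _ fun i _ => ?_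
          rw [norm_mul]
          gcongr
          exact h2 i
      _ ≤ _ := by rw [← Finset.sum_mul]; gcongr
  calc _ ≤ ((|B| + 1) * (p + q)) ^ 2 := by gcongr
    _ = (|B| + 1) ^ 2 * (p + q) ^ 2 := by ring
    _ ≤ (|B| + 1) ^ 2 * (2 * energy a z) := by
        gcongr
        unfold energy
        nlinarith [sq_nonneg (p - q)]
    _ = _ := by ring

/-- The integral of the inverse energy over the unit disc is at most of the order of a small
negative power of the resultant. -/
lemma exists_lintegral_energy_inv_le {θ : ℝ} (hθ0 : 0 < θ) (hθ1 : θ < 1)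
    {K : Set (Fin 4 → ℂ)} (hK : IsCompact K) (h0 : 0 ∉ K) :
    ∃ C : ENNReal, C ≠ ⊤ ∧ ∀ a ∈ K,
      ∫⁻ z in Metric.closedBall (0 : ℂ) 1, (ENNReal.ofReal (energy a z))⁻¹ ≤
        C * ‖(sylv a).det‖ₑ ^ (-(2 * θ)) := by
  obtain ⟨C, hC, hle⟩ := exists_lintegral_energy_rpow_le (s := 1 - θ) (by linarith) (by linarith)
    hK h0
  obtain ⟨B, hB, hdet⟩ := exists_norm_det_sylv_sq_le hK
  have hBt : ENNReal.ofReal B⁻¹ ^ (-θ) ≠ ⊤ := by simp [ENNReal.rpow_eq_top_iff, hB]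
  -- With `C + 1` the constant is nonzero, so that the right side is `⊤` where the resultant
  -- vanishes.
  refine ⟨ENNReal.ofReal B⁻¹ ^ (-θ) * (C + 1), ENNReal.mul_ne_top hBt (by simp [hC]),
    fun a ha => ?_⟩
  by_cases hd : ‖(sylv a).det‖ₑ ^ (-(2 * θ)) = ⊤
  · rw [hd, ENNReal.mul_top (mul_ne_zero ?_ (by simp))]
    · exact le_top
    · simp [ENNReal.rpow_eq_zero_iff, hθ0.le]
  have hdpos : 0 < ‖(sylv a).det‖ := by
    rw [norm_pos_iff]
    intro h
    rw [h, enorm_zero, ENNReal.zero_rpow_of_neg (by linarith)] at hd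
    exact hd rfl
  have hpt : ∀ z ∈ Metric.closedBall (0 : ℂ) 1, (ENNReal.ofReal (energy a z))⁻¹ ≤
      ENNReal.ofReal B⁻¹ ^ (-θ) * ‖(sylv a).det‖ₑ ^ (-(2 * θ)) *
        ENNReal.ofReal (energy a z) ^ (-(1 - θ)) := by
    intro z hz
    have hz' := hdet a ha z hz
    have h : 0 < energy a z := pos_of_mul_pos_right ((pow_pos hdpos 2).trans_le hz') hB.le
    -- The factor with exponent `-θ` is traded for the resultant; the exponent `1 - θ < 1` left over
    -- is uniformly integrable.
    have h1 : (ENNReal.ofReal (energy a z))⁻¹ =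
        ENNReal.ofReal (energy a z) ^ (-θ) * ENNReal.ofReal (energy a z) ^ (-(1 - θ)) := by
      rw [← ENNReal.rpow_add _ _ (by simpa using h) (by simp), ← ENNReal.rpow_neg_one]
      congr 1; ring
    rw [h1]
    gcongr
    rw [← mul_neg, ENNReal.rpow_mul, ← ENNReal.mul_rpow_of_ne_top (by simp) (by simp)]
    refine ennreal_rpow_neg_le_rpow_neg hθ0.le ?_
    rw [← ofReal_norm, ENNReal.rpow_ofNat, ← ENNReal.ofReal_pow (by positivity),
      ← ENNReal.ofReal_mul (by positivity)]
    refine ENNReal.ofReal_le_ofReal ?_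
    rw [inv_mul_le_iff₀ hB]
    exact hz'
  calc _ ≤ ∫⁻ z in Metric.closedBall (0 : ℂ) 1,
        ENNReal.ofReal B⁻¹ ^ (-θ) * ‖(sylv a).det‖ₑ ^ (-(2 * θ)) *
          ENNReal.ofReal (energy a z) ^ (-(1 - θ)) :=
        setLIntegral_mono' Metric.isClosed_closedBall.measurableSet hpt
    _ = ENNReal.ofReal B⁻¹ ^ (-θ) * ‖(sylv a).det‖ₑ ^ (-(2 * θ)) *
        ∫⁻ z in Metric.closedBall (0 : ℂ) 1, ENNReal.ofReal (energy a z) ^ (-(1 - θ)) :=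
        lintegral_const_mul' _ _ (ENNReal.mul_ne_top hBt hd)
    _ ≤ ENNReal.ofReal B⁻¹ ^ (-θ) * ‖(sylv a).det‖ₑ ^ (-(2 * θ)) * (C + 1) := by
        gcongr; exact (hle a ha).trans le_self_add
    _ = _ := by ring

/-! ### Negative powers of the resultant -/

/-- Since `|t - x| ≥ |t - Re x|`, a real `x` is the worst case. Within distance `1` the singularity
is integrable; beyond it the integrand is at most `1` on an interval of length `4`. -/
lemma lintegral_enorm_sub_rpow_le (x : ℂ) :
    ∫⁻ t in Set.Ioo (-2 : ℝ) 2, ‖(t : ℂ) - x‖ₑ ^ (-(1 / 2) : ℝ) ≤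
      (∫⁻ s in Metric.ball (0 : ℝ) 1, ‖s‖ₑ ^ (-(1 / 2) : ℝ)) + 4 := by
  have hpt : ∀ t : ℝ, ‖(t : ℂ) - x‖ₑ ^ (-(1 / 2) : ℝ) ≤
      (Metric.ball (0 : ℝ) 1).indicator (fun s => ‖s‖ₑ ^ (-(1 / 2) : ℝ)) (t - x.re) + 1 := by
    intro t
    have h1 : ‖t - x.re‖ₑ ≤ ‖(t : ℂ) - x‖ₑ := by
      rw [enorm_le_iff_norm_le]
      simpa using Complex.abs_re_le_norm ((t : ℂ) - x)
    refine (ennreal_rpow_neg_le_rpow_neg (by norm_num) h1).trans ?_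
    by_cases h : t - x.re ∈ Metric.ball (0 : ℝ) 1
    · rw [Set.indicator_of_mem h]
      exact le_self_add
    · rw [Set.indicator_of_notMem h, zero_add]
      rw [mem_ball_zero_iff, not_lt] at h
      refine (ennreal_rpow_neg_le_rpow_neg (x := 1) (by norm_num) ?_).trans (by simp)
      rw [← ofReal_norm]
      simpa using h
  calc _ ≤ ∫⁻ t in Set.Ioo (-2 : ℝ) 2, ((Metric.ball (0 : ℝ) 1).indicator
          (fun s => ‖s‖ₑ ^ (-(1 / 2) : ℝ)) (t - x.re) + 1) := lintegral_mono hpt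
    _ = (∫⁻ t in Set.Ioo (-2 : ℝ) 2, (Metric.ball (0 : ℝ) 1).indicator
          (fun s => ‖s‖ₑ ^ (-(1 / 2) : ℝ)) (t - x.re)) + 4 := by
        rw [lintegral_add_right _ measurable_const]
        congr 1
        simp
        norm_num
    _ ≤ (∫⁻ t, (Metric.ball (0 : ℝ) 1).indicator
          (fun s => ‖s‖ₑ ^ (-(1 / 2) : ℝ)) (t - x.re)) + 4 := by
        gcongr
        exact Measure.restrict_le_self
    _ = _ := by
        rw [lintegral_sub_right_eq_self (fun t => (Metric.ball (0 : ℝ) 1).indicator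
          (fun s => ‖s‖ₑ ^ (-(1 / 2) : ℝ)) t), lintegral_indicator Metric.isOpen_ball.measurableSet]

/-- A monic polynomial of degree six has an integrable negative power of exponent `1 / 12`, with
a bound that does not depend on its coefficients. -/
lemma exists_lintegral_prod_le :
    ∃ C : ENNReal, C ≠ ⊤ ∧ ∀ r : Fin 6 → ℂ,
      ∫⁻ t in Set.Ioo (-2 : ℝ) 2, ‖∏ i, ((t : ℂ) - r i)‖ₑ ^ (-(1 / 12) : ℝ) ≤ C := by
  have hfin := lintegral_enorm_rpow_ball_lt_top (volume : Measure ℝ) (by simp) (α := 1 / 2)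
    (by simp; norm_num) 1
  refine ⟨∑ _i : Fin 6, ((∫⁻ s in Metric.ball (0 : ℝ) 1, ‖s‖ₑ ^ (-(1 / 2) : ℝ)) + 4),
    ENNReal.sum_ne_top.2 fun i _ => ENNReal.add_ne_top.2 ⟨hfin.ne, by simp⟩, fun r => ?_⟩
  calc _ ≤ ∫⁻ t in Set.Ioo (-2 : ℝ) 2, ∑ i, ‖(t : ℂ) - r i‖ₑ ^ (-(1 / 2) : ℝ) := by
        refine lintegral_mono fun t => ?_
        -- The product is at least the sixth power of its smallest factor, and `6 · 1/12 = 1/2 < 1`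
        -- is integrable on the line. Summing over all `i` avoids a choice depending on `t`.
        obtain ⟨i, hi⟩ := Finite.exists_min fun i => ‖(t : ℂ) - r i‖ₑ
        have h1 : ‖(t : ℂ) - r i‖ₑ ^ (6 : ℝ) ≤ ‖∏ i, ((t : ℂ) - r i)‖ₑ := by
          rw [← ofReal_norm (∏ i, ((t : ℂ) - r i)), norm_prod, ENNReal.ofReal_prod_of_nonneg fun i _ => norm_nonneg _]
          simp only [ofReal_norm]
          calc _ = ∏ _k : Fin 6, ‖(t : ℂ) - r i‖ₑ := by simp
            _ ≤ _ := Finset.prod_le_prod' fun k _ => hi k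
        calc _ ≤ (‖(t : ℂ) - r i‖ₑ ^ (6 : ℝ)) ^ (-(1 / 12) : ℝ) :=
              ennreal_rpow_neg_le_rpow_neg (by norm_num) h1
          _ = ‖(t : ℂ) - r i‖ₑ ^ (-(1 / 2) : ℝ) := by
              rw [← ENNReal.rpow_mul]; norm_num
          _ ≤ _ := Finset.single_le_sum (f := fun i => ‖(t : ℂ) - r i‖ₑ ^ (-(1 / 2) : ℝ))
              (fun _ _ => zero_le) (Finset.mem_univ i)
    _ = ∑ i, ∫⁻ t in Set.Ioo (-2 : ℝ) 2, ‖(t : ℂ) - r i‖ₑ ^ (-(1 / 2) : ℝ) :=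
        lintegral_finsetSum _ fun i _ => by fun_prop
    _ ≤ _ := Finset.sum_le_sum fun i _ => lintegral_enorm_sub_rpow_le (r i)

/-- The determinant of a matrix pencil `S + t D`, `|det D| = 1`, is a monic polynomial in `t` up
to a constant of modulus one. -/
lemma exists_norm_det_pencil (S D : Matrix (Fin 6) (Fin 6) ℂ) (hD : ‖D.det‖ = 1) :
    ∃ r : Fin 6 → ℂ, ∀ t : ℂ, ‖(S + t • D).det‖ = ‖∏ i, (t - r i)‖ := by
  have hu : IsUnit D.det := by
    rw [isUnit_iff_ne_zero, ← norm_ne_zero_iff, hD]; exact one_ne_zero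
  -- `S + tD = D (t - M)`, so the determinant is `det D` times the characteristic polynomial of `M`
  -- at `t`, and the `r i` are the eigenvalues.
  set M : Matrix (Fin 6) (Fin 6) ℂ := -(D⁻¹ * S) with hM
  have hsplit : M.charpoly.Splits := IsAlgClosed.splits _
  have hcard : M.charpoly.roots.toList.length = 6 := by
    rw [Multiset.length_toList, ← hsplit.natDegree_eq_card_roots, Matrix.charpoly_natDegree_eq_dim]
    simp
  refine ⟨fun i => M.charpoly.roots.toList.get (i.cast hcard.symm), fun t => ?_⟩
  have h1 : M.charpoly.eval t = ∏ i : Fin 6, (t - M.charpoly.roots.toList.get (i.cast hcard.symm)) := by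
    rw [hsplit.eval_eq_prod_roots_of_monic M.charpoly_monic]
    conv_lhs => rw [← Multiset.coe_toList M.charpoly.roots]
    rw [Multiset.map_coe, Multiset.prod_coe]
    conv_lhs => rw [← List.ofFn_get M.charpoly.roots.toList]
    rw [List.map_ofFn, List.prod_ofFn]
    exact (Fintype.prod_equiv (finCongr hcard.symm) _ _ fun i => rfl).symm
  have h2 : S + t • D = D * (Matrix.scalar (Fin 6) t - M) := by
    rw [hM, sub_neg_eq_add, mul_add, ← mul_assoc, Matrix.mul_nonsing_inv _ hu, one_mul, add_comm]
    congr 1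
    rw [Matrix.scalar_apply, ← Matrix.smul_one_eq_diagonal, Matrix.mul_smul, mul_one]
  rw [h2, Matrix.det_mul, norm_mul, hD, one_mul, ← Matrix.eval_charpoly, h1]

/-- Only for real `t`: the conjugated entries are not complex linear in the coefficients. -/
lemma sylv_add_smul (a b : Fin 4 → ℂ) (t : ℝ) :
    sylv (a + (t : ℂ) • b) = sylv a + (t : ℂ) • sylv b := by
  ext i k
  fin_cases i <;> fin_cases k <;> simp [sylv] <;> ring

lemma norm_det_sylv_single {w : ℂ} (hw : ‖w‖ = 1) : ‖(sylv ![w, 0, 0, 0]).det‖ = 1 := by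
  have : sylv ![w, 0, 0, 0] = Matrix.diagonal ![w, w, w, -conj w, -conj w, -conj w] := by
    ext i k
    fin_cases i <;> fin_cases k <;> simp [sylv]
  rw [this, Matrix.det_diagonal, norm_prod, Fin.prod_univ_six]
  simp [hw]

/-- Each affine chart has a coordinate in which the resultant is a monic polynomial, up to a
constant of modulus one. -/
lemma exists_norm_det_sylv_lumpDir (j : Fin 8) : ∃ k, ‖(sylv (lumpDir j k)).det‖ = 1 := by
  -- In chart `0` the real part of `a₀` is frozen at `1`; coordinate `3` is then its imaginary part.
  -- In the other charts coordinate `0` is its real part.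
  by_cases hj : j = 0
  · refine ⟨3, ?_⟩
    have : lumpDir j 3 = ![Complex.I, 0, 0, 0] := by
      subst hj
      funext i
      fin_cases i <;> apply Complex.ext <;> simp [lumpDir, coeffs]
    rw [this]
    exact norm_det_sylv_single Complex.norm_I
  · refine ⟨0, ?_⟩
    have : lumpDir j 0 = ![1, 0, 0, 0] := by
      have h0 : j.succAbove 0 = 0 := Fin.succAbove_ne_zero_zero hj
      rw [lumpDir, h0]
      funext i
      fin_cases i <;> apply Complex.ext <;> simp [coeffs]
    rw [this]
    exact norm_det_sylv_single norm_one

lemma continuous_lumpCoeffs (j : Fin 8) : Continuous (lumpCoeffs j) := by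
  have hi : ∀ i : Fin 8, Continuous fun y : Fin 7 → ℝ =>
      j.insertNth (α := fun _ => ℝ) 1 y i := by
    intro i
    rcases Fin.eq_self_or_eq_succAbove j i with rfl | ⟨k, rfl⟩
    · simpa using continuous_const
    · simpa using continuous_apply k
  refine continuous_pi fun k => ?_
  have : (fun y => lumpCoeffs j y k) = fun y =>
      ((j.insertNth (α := fun _ => ℝ) 1 y (Fin.castAdd 4 k) : ℝ) : ℂ) +
      ((j.insertNth (α := fun _ => ℝ) 1 y (Fin.natAdd 4 k) : ℝ) : ℂ) * Complex.I := by
    funext y; exact Complex.mk_eq_add_mul_I _ _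
  rw [this]
  have := hi (Fin.castAdd 4 k)
  have := hi (Fin.natAdd 4 k)
  fun_prop

lemma lumpCoeffs_ne_zero (j : Fin 8) (y : Fin 7 → ℝ) : lumpCoeffs j y ≠ 0 := by
  intro h
  have key : ∀ i : Fin 8, j.insertNth (α := fun _ => ℝ) 1 y i = 0 := by
    refine Fin.addCases (m := 4) (n := 4) (fun k => ?_) (fun k => ?_)
    · exact congrArg Complex.re (congrFun h k)
    · exact congrArg Complex.im (congrFun h k)
  have := key j
  rw [Fin.insertNth_apply_same] at this
  exact one_ne_zero this

/-- Fubini: integrating first along the coordinate of `exists_norm_det_sylv_lumpDir` gives a bound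
independent of the other six, which range over a bounded cube. -/
lemma lintegral_det_sylv_lt_top (j : Fin 8) :
    ∫⁻ y in Set.univ.pi fun _ : Fin 7 => Set.Ioo (-2 : ℝ) 2,
      ‖(sylv (lumpCoeffs j y)).det‖ₑ ^ (-(1 / 12) : ℝ) < ⊤ := by
  obtain ⟨k, hk⟩ := exists_norm_det_sylv_lumpDir j
  obtain ⟨C, hC, hle⟩ := exists_lintegral_prod_le
  have hcont : Continuous fun y => (sylv (lumpCoeffs j y)).det :=
    (continuous_sylv.comp (continuous_lumpCoeffs j)).matrix_det
  set f : (Fin 7 → ℝ) → ENNReal := fun y => ‖(sylv (lumpCoeffs j y)).det‖ₑ ^ (-(1 / 12) : ℝ)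
  have hf : Measurable f := hcont.measurable.enorm.pow_const _
  have hline : ∀ y' : Fin 6 → ℝ, ∫⁻ t in Set.Ioo (-2 : ℝ) 2,
      f (k.insertNth (α := fun _ => ℝ) t y') ≤ C := by
    intro y'
    obtain ⟨r, hr⟩ := exists_norm_det_pencil
      (sylv (lumpCoeffs j (k.insertNth (α := fun _ => ℝ) 0 y'))) _ hk
    refine le_trans (le_of_eq (lintegral_congr fun t => ?_)) (hle r)
    have h1 : k.insertNth (α := fun _ => ℝ) t y' =
        k.insertNth (α := fun _ => ℝ) 0 y' + t • Pi.single k 1 := by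
      rw [Fin.insertNth_eq_iff]
      constructor
      · simp
      · funext i
        simp [Fin.removeNth, Fin.succAbove_ne]
    simp only [f]
    rw [h1, lumpCoeffs_add_single, sylv_add_smul, ← ofReal_norm, hr, ofReal_norm]
  have hpi : MeasurableSet (Set.univ.pi fun _ : Fin 7 => Set.Ioo (-2 : ℝ) 2) :=
    MeasurableSet.univ_pi fun _ => measurableSet_Ioo
  have hpi' : MeasurableSet (Set.univ.pi fun _ : Fin 6 => Set.Ioo (-2 : ℝ) 2) :=
    MeasurableSet.univ_pi fun _ => measurableSet_Ioo
  have hmp := (volume_preserving_piFinSuccAbove (fun _ : Fin 7 => ℝ) k).symm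
  have hpre : (MeasurableEquiv.piFinSuccAbove (fun _ : Fin 7 => ℝ) k).symm ⁻¹'
      (Set.univ.pi fun _ : Fin 7 => Set.Ioo (-2 : ℝ) 2) =
      Set.Ioo (-2 : ℝ) 2 ×ˢ Set.univ.pi fun _ : Fin 6 => Set.Ioo (-2 : ℝ) 2 := by
    ext ⟨t, y'⟩
    simp only [Set.mem_preimage, MeasurableEquiv.piFinSuccAbove_symm_apply, Set.mem_univ_pi,
      Set.mem_prod, Fin.insertNthEquiv_apply]
    rw [Fin.forall_iff_succAbove k]
    simp
  rw [← hmp.setLIntegral_comp_preimage hpi hf, hpre, Measure.volume_eq_prod,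
    ← Measure.prod_restrict, lintegral_prod_symm _ (by
      refine Measurable.aemeasurable ?_
      exact hf.comp (MeasurableEquiv.measurable _))]
  calc _ ≤ ∫⁻ _y in Set.univ.pi fun _ : Fin 6 => Set.Ioo (-2 : ℝ) 2, C :=
        lintegral_mono fun y' => hline y'
    _ < ⊤ := by
        rw [setLIntegral_const, volume_pi_pi]
        simp only [Real.volume_Ioo]
        exact ENNReal.mul_lt_top hC.lt_top (ENNReal.prod_lt_top fun _ _ => by simp)

/-! ### The Riemannian density and finiteness of the volume -/

lemma enorm_det_le {n : ℕ} (hn : n ≠ 0) (G : Matrix (Fin n) (Fin n) ℝ) {I : ENNReal}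
    (h : ∀ k l, ‖G k l‖ₑ ≤ I) : ‖G.det‖ₑ ≤ n.factorial * I ^ n := by
  by_cases hI : I = ⊤
  · rw [hI, ENNReal.top_pow hn, ENNReal.mul_top (by exact_mod_cast n.factorial_ne_zero)]
    exact le_top
  · lift I to NNReal using hI
    have h1 := Matrix.det_le (A := G) (abv := AbsoluteValue.abs) (x := (I : ℝ)) fun k l => by
      have := h k l
      rw [← ofReal_norm, ENNReal.ofReal_le_iff_le_toReal (by simp)] at this
      simpa using this
    simp only [AbsoluteValue.abs_apply, Fintype.card_fin, nsmul_eq_mul] at h1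
    rw [← ofReal_norm, Real.norm_eq_abs]
    refine (ENNReal.ofReal_le_ofReal h1).trans (le_of_eq ?_)
    rw [ENNReal.ofReal_mul (by positivity), ENNReal.ofReal_natCast, ENNReal.ofReal_pow (by positivity),
      ENNReal.ofReal_coe_nnreal]

/-- In each affine chart the Riemannian density is at most of the order of a small negative power
of the resultant. -/
lemma exists_volumeDensity_le (j : Fin 8) : ∃ C : ENNReal, C ≠ ⊤ ∧ ∀ y ∈ lumpDom j,
    ENNReal.ofReal (Real.sqrt |(l2Gram (lumpChart j) y).det|) ≤
      C * ‖(sylv (lumpCoeffs j y)).det‖ₑ ^ (-(1 / 12) : ℝ) := by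
  have hK : IsCompact (lumpCoeffs j '' Set.univ.pi fun _ : Fin 7 => Set.Icc (-2 : ℝ) 2) :=
    (isCompact_univ_pi fun _ => isCompact_Icc).image (continuous_lumpCoeffs j)
  -- Seven factors of order `|Res|^(-2θ)` under a square root give `|Res|^(-7θ)`, which is
  -- `|Res|^(-1/12)` for `θ = 1/84`.
  obtain ⟨C, hC, hle⟩ := exists_lintegral_energy_inv_le (θ := 1 / 84) (by norm_num) (by norm_num) hK
    (by rintro ⟨y, -, hy⟩; exact lumpCoeffs_ne_zero j y hy)
  refine ⟨(Nat.factorial 7 * (512 * C) ^ 7) ^ (1 / 2 : ℝ), ?_, fun y hy => ?_⟩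
  · refine ENNReal.rpow_ne_top_of_nonneg (by norm_num) (ENNReal.mul_ne_top (by simp) ?_)
    exact ENNReal.pow_ne_top (ENNReal.mul_ne_top (by simp) hC)
  set d := ‖(sylv (lumpCoeffs j y)).det‖ₑ
  have h1 : ∀ k l, ‖l2Gram (lumpChart j) y k l‖ₑ ≤ 512 * C * d ^ (-(2 * (1 / 84)) : ℝ) := by
    intro k l
    refine (enorm_l2Gram_le hy k l).trans ((lintegral_energy_le _).trans ?_)
    rw [mul_assoc]
    gcongr
    refine hle _ ⟨y, fun k _ => ?_, rfl⟩
    have := hy.1 k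
    rw [abs_lt] at this
    exact ⟨this.1.le, this.2.le⟩
  have h2 := enorm_det_le (by norm_num) _ h1
  calc _ = ‖(l2Gram (lumpChart j) y).det‖ₑ ^ (1 / 2 : ℝ) := by
        rw [Real.sqrt_eq_rpow, ← ENNReal.ofReal_rpow_of_nonneg (abs_nonneg _) (by norm_num),
          ← Real.norm_eq_abs, ofReal_norm]
    _ ≤ (Nat.factorial 7 * (512 * C * d ^ (-(2 * (1 / 84)) : ℝ)) ^ 7) ^ (1 / 2 : ℝ) :=
        ENNReal.rpow_le_rpow h2 (by norm_num)
    _ = _ := by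
        rw [mul_pow, ← mul_assoc, ENNReal.mul_rpow_of_nonneg _ _ (by norm_num)]
        congr 1
        rw [← ENNReal.rpow_natCast, ← ENNReal.rpow_mul, ← ENNReal.rpow_mul]
        norm_num

/-- The moduli space has finite volume. -/
theorem lumpVolume_lt_top : lumpVolume < ⊤ := by
  rw [lumpVolume, atlasVolume, ENNReal.sum_lt_top]
  intro j _
  obtain ⟨C, hC, hle⟩ := exists_volumeDensity_le j
  calc _ ≤ ∫⁻ y in lumpDom j, ENNReal.ofReal (Real.sqrt |(l2Gram (lumpChart j) y).det|) :=
        lintegral_mono_set fun y hy => hy.1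
    _ ≤ ∫⁻ y in lumpDom j, C * ‖(sylv (lumpCoeffs j y)).det‖ₑ ^ (-(1 / 12) : ℝ) :=
        setLIntegral_mono' (isOpen_lumpDom j).measurableSet hle
    _ ≤ ∫⁻ y in Set.univ.pi fun _ : Fin 7 => Set.Ioo (-2 : ℝ) 2,
          C * ‖(sylv (lumpCoeffs j y)).det‖ₑ ^ (-(1 / 12) : ℝ) :=
        lintegral_mono_set fun y hy k _ => abs_lt.1 (hy.1 k)
    _ < ⊤ := by
        rw [lintegral_const_mul' _ _ hC]
        exact ENNReal.mul_lt_top hC.lt_top (lintegral_det_sylv_lt_top j)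

/-! ### The deformations of the symmetric maps -/

/-- The coefficients of the `D₂`-symmetric map. -/
def rcCoeffs (c : ℝ) : Fin 4 → ℂ := ![0, c, 0, 1]

lemma num_rcCoeffs (c : ℝ) : num (rcCoeffs c) = X ^ 3 + C (c : ℂ) * X := by
  simp [num, rcCoeffs, Fin.sum_univ_four]; ring

lemma den_rcCoeffs (c : ℝ) : den (rcCoeffs c) = C (c : ℂ) * X ^ 2 + 1 := by
  rw [den_eq]; simp [num, rcCoeffs, Fin.sum_univ_four]; ring

lemma Rc_eq (c : ℝ) : Rc c = ratMap (num (rcCoeffs c)) (den (rcCoeffs c)) := by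
  rw [num_rcCoeffs, den_rcCoeffs, Rc]

lemma affine_Rc (c : ℝ) (z : ℂ) : affine (Rc c) z = (z ^ 3 + c * z) / (c * z ^ 2 + 1) := by
  rw [Rc, affine_ratMap]; simp

lemma den_rcCoeffs_eval (c : ℝ) (z : ℂ) : (den (rcCoeffs c)).eval z = c * z ^ 2 + 1 := by
  rw [den_rcCoeffs]; simp

lemma isCoprime_rcCoeffs {c : ℝ} (hc0 : 0 ≤ c) (hc1 : c ≠ 1) :
    IsCoprime (num (rcCoeffs c)) (den (rcCoeffs c)) := by
  rw [isCoprime_iff]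
  rintro z ⟨h1, h2⟩
  rw [num_rcCoeffs] at h1
  rw [den_rcCoeffs_eval] at h2
  simp only [eval_add, eval_pow, eval_X, eval_mul, eval_C] at h1
  -- `c P - X Q = (c² - 1) X`, and `Q(0) = 1`.
  have h3 : z * ((c : ℂ) ^ 2 - 1) = 0 := by linear_combination (c : ℂ) * h1 - z * h2
  rcases mul_eq_zero.1 h3 with h | h
  · rw [h] at h2; simp at h2
  · have : (c : ℝ) ^ 2 - 1 = 0 := by exact_mod_cast h
    have : (c - 1) * (c + 1) = 0 := by linear_combination this
    rcases mul_eq_zero.1 this with h | h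
    · exact hc1 (by linarith)
    · linarith

/-- The deformations of the symmetric map: rotations of the domain, rotations of the target, and
the change of the parameter. -/
def symField (c : ℝ) : (Fin 3 ⊕ Fin 3) ⊕ Unit → ℂ → ℂ
  | .inl (.inl i), z => rotField i z * deriv (affine (Rc c)) z
  | .inl (.inr i), z => rotField i (affine (Rc c) z)
  | .inr _, z => deriv (fun s : ℝ => affine (Rc s) z) c

/-- The parity of the deformations. -/
def symParity : (Fin 3 ⊕ Fin 3) ⊕ Unit → ℝ
  | .inl (.inl i) => ![1, 1, -1] i
  | .inl (.inr i) => ![1, 1, -1] i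
  | .inr _ => -1

/-- The behaviour of the deformations under complex conjugation. -/
def symReality : (Fin 3 ⊕ Fin 3) ⊕ Unit → ℝ
  | .inl (.inl i) => ![-1, 1, -1] i
  | .inl (.inr i) => ![-1, 1, -1] i
  | .inr _ => 1

/-! ### Behaviour of the deformations under `z ↦ -z` and conjugation -/

lemma affine_Rc_neg (c : ℝ) (z : ℂ) : affine (Rc c) (-z) = -affine (Rc c) z := by
  rw [affine_Rc, affine_Rc, ← neg_div]
  congr 1 <;> ring

lemma affine_Rc_conj (c : ℝ) (z : ℂ) : affine (Rc c) (conj z) = conj (affine (Rc c) z) := by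
  rw [affine_Rc, affine_Rc]
  simp

/-- `deriv_comp_neg` needs no differentiability, so poles require no exception. -/
lemma deriv_affine_Rc_neg (c : ℝ) (z : ℂ) :
    deriv (affine (Rc c)) (-z) = deriv (affine (Rc c)) z := by
  have h := deriv_comp_neg (affine (Rc c)) z
  simp only [affine_Rc_neg, deriv.fun_neg] at h
  exact (neg_injective h).symm

lemma deriv_affine_Rc_conj (c : ℝ) (z : ℂ) :
    deriv (affine (Rc c)) (conj z) = conj (deriv (affine (Rc c)) z) := by
  have h : (conj ∘ affine (Rc c) ∘ conj) = affine (Rc c) := by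
    funext w
    simp [affine_Rc_conj]
  have := congrFun (deriv_conj_conj (f := affine (Rc c))) (conj z)
  rw [h] at this
  simpa using this

lemma rotField_neg (i : Fin 3) (z : ℂ) :
    rotField i (-z) = ((![1, 1, -1] : Fin 3 → ℝ) i : ℂ) * rotField i z := by
  fin_cases i <;> simp [rotField]

lemma rotField_conj (i : Fin 3) (z : ℂ) :
    rotField i (conj z) = ((![-1, 1, -1] : Fin 3 → ℝ) i : ℂ) * conj (rotField i z) := by
  fin_cases i <;> simp [rotField, neg_div, map_ofNat]

lemma symField_neg (c : ℝ) (x : (Fin 3 ⊕ Fin 3) ⊕ Unit) (z : ℂ) :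
    symField c x (-z) = (symParity x : ℂ) * symField c x z := by
  rcases x with (i | i) | _
  · simp only [symField, symParity]
    rw [deriv_affine_Rc_neg, rotField_neg, mul_assoc]
  · simp only [symField, symParity]
    rw [affine_Rc_neg, rotField_neg]
  · simp [symField, symParity, affine_Rc_neg]

lemma symField_conj (c : ℝ) (x : (Fin 3 ⊕ Fin 3) ⊕ Unit) (z : ℂ) :
    symField c x (conj z) = (symReality x : ℂ) * conj (symField c x z) := by
  rcases x with (i | i) | _
  · simp only [symField, symReality]
    rw [deriv_affine_Rc_conj, rotField_conj, map_mul, mul_assoc]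
  · simp only [symField, symReality]
    rw [affine_Rc_conj, rotField_conj]
  · simp only [symField, symReality, affine_Rc_conj, Complex.ofReal_one, one_mul]
    exact deriv.star (f := fun s : ℝ => affine (Rc s) z)

/-- The substitution `z ↦ -z` preserves the area, `|z|` and `|R_c|`, and multiplies the two fields
by their parities. If the product is `-1`, the integral vanishes. -/
lemma l2Inner_symField_parity (c : ℝ) (x y : (Fin 3 ⊕ Fin 3) ⊕ Unit) :
    l2Inner (Rc c) (symField c x) (symField c y) =
      symParity x * symParity y * l2Inner (Rc c) (symField c x) (symField c y) := by
  conv_lhs => rw [l2Inner, ← integral_neg_eq_self]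
  rw [l2Inner, ← integral_const_mul]
  congr 1
  funext z
  rw [l2Density, l2Density, affine_Rc_neg, norm_neg, norm_neg, symField_neg, symField_neg,
    ← mul_div_assoc, map_mul, Complex.conj_ofReal, ← Complex.re_ofReal_mul]
  congr 2
  push_cast
  ring

lemma l2Inner_symField_reality (c : ℝ) (x y : (Fin 3 ⊕ Fin 3) ⊕ Unit) :
    l2Inner (Rc c) (symField c x) (symField c y) =
      symReality x * symReality y * l2Inner (Rc c) (symField c x) (symField c y) := by
  have hconj : MeasurePreserving (fun z : ℂ => conj z) :=
    Complex.conjLIE.measurePreserving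
  conv_lhs => rw [l2Inner, ← hconj.integral_comp
    Complex.conjLIE.toHomeomorph.measurableEmbedding]
  rw [l2Inner, ← integral_const_mul]
  congr 1
  funext z
  rw [l2Density, l2Density, affine_Rc_conj, RCLike.norm_conj, RCLike.norm_conj, symField_conj,
    symField_conj, ← mul_div_assoc, map_mul, Complex.conj_ofReal, ← Complex.re_ofReal_mul]
  congr 1
  rw [← Complex.conj_re]
  congr 1
  simp only [map_mul, Complex.conj_conj, Complex.conj_ofReal]
  push_cast
  ring

/-- Deformations of different symmetry types are orthogonal. -/
lemma l2Inner_symField_eq_zero (c : ℝ) {x y : (Fin 3 ⊕ Fin 3) ⊕ Unit}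
    (h : symParity x * symParity y = -1 ∨ symReality x * symReality y = -1) :
    l2Inner (Rc c) (symField c x) (symField c y) = 0 := by
  rcases h with h | h
  · have := l2Inner_symField_parity c x y
    rw [h] at this
    linarith
  · have := l2Inner_symField_reality c x y
    rw [h] at this
    linarith

lemma l2Inner_comm (R : OnePoint ℂ → OnePoint ℂ) (u v : ℂ → ℂ) :
    l2Inner R u v = l2Inner R v u := by
  rw [l2Inner, l2Inner]
  congr 1
  funext z
  rw [l2Density, l2Density, ← Complex.conj_re]
  simp [mul_comm]

/-! ### Growth and integrability of the symmetric deformations -/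

lemma hasDerivAt_affine_Rc {c : ℝ} {z : ℂ} (hz : (c : ℂ) * z ^ 2 + 1 ≠ 0) :
    HasDerivAt (affine (Rc c))
      (((c : ℂ) * z ^ 4 + (3 - c ^ 2) * z ^ 2 + c) / (c * z ^ 2 + 1) ^ 2) z := by
  have h1 : HasDerivAt (fun z : ℂ => z ^ 3 + c * z) (3 * z ^ 2 + c) z := by
    simpa using (hasDerivAt_pow 3 z).fun_add ((hasDerivAt_id' z).const_mul (c : ℂ))
  have h2 : HasDerivAt (fun z : ℂ => c * z ^ 2 + 1) (c * (2 * z)) z := by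
    simpa using ((hasDerivAt_pow 2 z).const_mul (c : ℂ)).add_const 1
  have hfun : affine (Rc c) = fun z : ℂ => (z ^ 3 + c * z) / (c * z ^ 2 + 1) :=
    funext fun z => affine_Rc c z
  rw [hfun]
  refine (h1.div h2 hz).congr_deriv ?_
  congr 1
  ring

lemma hasDerivAt_affine_Rc_param {c : ℝ} {z : ℂ} (hz : (c : ℂ) * z ^ 2 + 1 ≠ 0) :
    HasDerivAt (fun s : ℝ => affine (Rc s) z) ((z - z ^ 5) / (c * z ^ 2 + 1) ^ 2) c := by
  have hid : HasDerivAt (fun s : ℝ => (s : ℂ)) 1 c := Complex.ofRealCLM.hasDerivAt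
  have h1 : HasDerivAt (fun s : ℝ => z ^ 3 + s * z) z c := by
    simpa using (hid.mul_const z).const_add (z ^ 3)
  have h2 : HasDerivAt (fun s : ℝ => s * z ^ 2 + 1) (z ^ 2) c := by
    simpa using (hid.mul_const (z ^ 2)).add_const 1
  simp only [affine_Rc]
  refine (h1.div h2 hz).congr_deriv ?_
  congr 1
  ring

/-- The numerators of the deformations. -/
def symNum (c : ℝ) : (Fin 3 ⊕ Fin 3) ⊕ Unit → ℂ[X]
  | .inl (.inl i) => ![C (Complex.I / 2) * (1 - X ^ 2), C (1 / 2) * (1 + X ^ 2), C Complex.I * X] i *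
      (C (c : ℂ) * X ^ 4 + C (3 - (c : ℂ) ^ 2) * X ^ 2 + C (c : ℂ))
  | .inl (.inr i) =>
      ![C (Complex.I / 2) * ((C (c : ℂ) * X ^ 2 + 1) ^ 2 - (X ^ 3 + C (c : ℂ) * X) ^ 2),
        C (1 / 2) * ((C (c : ℂ) * X ^ 2 + 1) ^ 2 + (X ^ 3 + C (c : ℂ) * X) ^ 2),
        C Complex.I * ((X ^ 3 + C (c : ℂ) * X) * (C (c : ℂ) * X ^ 2 + 1))] i
  | .inr _ => X - X ^ 5

lemma symNum_natDegree (c : ℝ) (x : (Fin 3 ⊕ Fin 3) ⊕ Unit) : (symNum c x).natDegree ≤ 6 := by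
  rcases x with (i | i) | _
  · fin_cases i <;> simp only [symNum] <;> simp <;> compute_degree!
  · fin_cases i <;> simp only [symNum] <;> simp <;> compute_degree!
  · simp only [symNum]; compute_degree!

/-- Degree six is the growth that `integrable_l2Density` allows for a numerator over `Q²`. -/
lemma exists_norm_eval_le {p : ℂ[X]} (hp : p.natDegree ≤ 6) :
    ∃ K, ∀ z, ‖p.eval z‖ ≤ K * (1 + ‖z‖ ^ 2) ^ 3 := by
  refine ⟨∑ i ∈ Finset.range 7, ‖p.coeff i‖, fun z => ?_⟩
  rw [eval_eq_sum_range' (by omega : p.natDegree < 7), Finset.sum_mul]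
  refine norm_sum_le_of_le _ fun i hi => ?_
  rw [norm_mul, norm_pow]
  gcongr
  have hi : i ≤ 6 := by rw [Finset.mem_range] at hi; omega
  rcases le_total ‖z‖ 1 with h | h
  · exact (pow_le_one₀ (norm_nonneg _) h).trans (one_le_pow₀ (by nlinarith [norm_nonneg z]))
  · calc ‖z‖ ^ i ≤ ‖z‖ ^ 6 := pow_le_pow_right₀ h hi
      _ = (‖z‖ ^ 2) ^ 3 := by ring
      _ ≤ _ := by gcongr; linarith

lemma symField_eq {c : ℝ} (x : (Fin 3 ⊕ Fin 3) ⊕ Unit) {z : ℂ} (hz : (c : ℂ) * z ^ 2 + 1 ≠ 0) :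
    symField c x z = (symNum c x).eval z / (c * z ^ 2 + 1) ^ 2 := by
  rcases x with (i | i) | _
  · simp only [symField, symNum, (hasDerivAt_affine_Rc hz).deriv, eval_mul]
    rw [mul_div_assoc]
    congr 1
    · fin_cases i <;> simp [rotField]; ring
    · simp
  · simp only [symField, symNum, affine_Rc]
    fin_cases i <;> simp [rotField] <;> generalize (c : ℂ) * z ^ 2 + 1 = q at hz ⊢ <;> field_simp
  · simp only [symField, symNum, (hasDerivAt_affine_Rc_param hz).deriv]
    simp

lemma integrable_symField {c : ℝ} (hc0 : 0 ≤ c) (hc1 : c ≠ 1) (x y : (Fin 3 ⊕ Fin 3) ⊕ Unit) :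
    Integrable (l2Density (Rc c) (symField c x) (symField c y)) := by
  obtain ⟨K, hK⟩ := exists_norm_eval_le (symNum_natDegree c x)
  obtain ⟨K', hK'⟩ := exists_norm_eval_le (symNum_natDegree c y)
  rw [Rc_eq]
  refine integrable_l2Density (isCoprime_rcCoeffs hc0 hc1) (symNum c x).continuous
    (symNum c y).continuous hK hK' ?_ ?_ <;>
  · intro z hz
    rw [den_rcCoeffs_eval] at hz ⊢
    exact symField_eq _ hz

/-! ### The Gram matrix of the symmetric deformations -/

lemma l2Inner_sum {ι : Type*} [Fintype ι] {R : OnePoint ℂ → OnePoint ℂ} {f : ι → ℂ → ℂ}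
    (hf : ∀ x y, Integrable (l2Density R (f x) (f y))) (ξ : ι → ℝ) :
    l2Inner R (fun z => ∑ x, (ξ x : ℂ) * f x z) (fun z => ∑ x, (ξ x : ℂ) * f x z) =
      ∑ x, ∑ y, ξ x * ξ y * l2Inner R (f x) (f y) := by
  have h : ∀ z, l2Density R (fun z => ∑ x, (ξ x : ℂ) * f x z) (fun z => ∑ x, (ξ x : ℂ) * f x z) z =
      ∑ x, ∑ y, ξ x * ξ y * l2Density R (f x) (f y) z := by
    intro z
    simp only [l2Density, map_sum, Finset.sum_mul_sum, Complex.re_sum, Finset.sum_div]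
    refine Finset.sum_congr rfl fun x _ => Finset.sum_congr rfl fun y _ => ?_
    rw [← mul_div_assoc, ← Complex.re_ofReal_mul]
    congr 2
    simp only [map_mul, Complex.conj_ofReal]
    push_cast
    ring
  rw [l2Inner]
  simp only [h]
  rw [integral_finsetSum _ fun x _ => integrable_finsetSum _ fun y _ => (hf x y).const_mul _]
  refine Finset.sum_congr rfl fun x _ => ?_
  rw [integral_finsetSum _ fun y _ => (hf x y).const_mul _]
  refine Finset.sum_congr rfl fun y _ => ?_
  rw [integral_const_mul, l2Inner]

lemma metricA_eq (i : Fin 3) (c : ℝ) : metricA i c =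
    l2Inner (Rc c) (symField c (.inl (.inl i))) (symField c (.inl (.inl i))) := by
  rw [metricA, l2Inner]
  congr 1
  funext z
  rw [l2Density, Complex.mul_conj, Complex.ofReal_re, Complex.normSq_eq_norm_sq]
  simp only [symField, norm_mul, mul_pow]

lemma metricD_eq (i : Fin 3) (c : ℝ) : metricD i c =
    l2Inner (Rc c) (symField c (.inl (.inr i))) (symField c (.inl (.inr i))) := by
  rw [metricD, l2Inner]
  congr 1
  funext z
  rw [l2Density, Complex.mul_conj, Complex.ofReal_re, Complex.normSq_eq_norm_sq]
  simp only [symField]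

lemma metricC_eq (c : ℝ) : metricC c =
    l2Inner (Rc c) (symField c (.inr ())) (symField c (.inr ())) := by
  rw [metricC, l2Inner]
  congr 1
  funext z
  rw [l2Density, Complex.mul_conj, Complex.ofReal_re, Complex.normSq_eq_norm_sq]
  simp only [symField]

lemma metricF_eq (i : Fin 3) (c : ℝ) : metricF i c =
    2 * l2Inner (Rc c) (symField c (.inl (.inl i))) (symField c (.inl (.inr i))) := rfl

/-- The `L²` norm of a deformation of the symmetric map. -/
lemma l2Inner_symField {c : ℝ} (hc0 : 0 ≤ c) (hc1 : c ≠ 1) (σ η : Fin 3 → ℝ) (c' : ℝ)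
    {V : ℂ → ℂ} (hV : V = fun z => ∑ x, ((Sum.elim (Sum.elim σ η) (fun _ => c') x : ℝ) : ℂ) *
      symField c x z) :
    l2Inner (Rc c) V V = metricC c * c' ^ 2 +
      ∑ i, (metricA i c * σ i ^ 2 + metricD i c * η i ^ 2 + metricF i c * (σ i * η i)) := by
  rw [hV, l2Inner_sum (integrable_symField hc0 hc1)]
  have hz : ∀ x y, symParity x * symParity y = -1 ∨ symReality x * symReality y = -1 →
      l2Inner (Rc c) (symField c x) (symField c y) = 0 := fun x y =>
    l2Inner_symField_eq_zero c
  have hcomm : ∀ i, l2Inner (Rc c) (symField c (.inl (.inr i))) (symField c (.inl (.inl i))) =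
      l2Inner (Rc c) (symField c (.inl (.inl i))) (symField c (.inl (.inr i))) := fun i =>
    l2Inner_comm _ _ _
  -- The pairs (parity, reality) are `(+,-)`, `(+,+)`, `(-,-)` for the three axes and `(-,+)` for
  -- `∂_c R_c`: all different.
  have hoff : ∀ i k : Fin 3, i ≠ k → (![1, 1, -1] : Fin 3 → ℝ) i * (![1, 1, -1] : Fin 3 → ℝ) k = -1 ∨
      (![-1, 1, -1] : Fin 3 → ℝ) i * (![-1, 1, -1] : Fin 3 → ℝ) k = -1 := by
    intro i k hik
    fin_cases i <;> fin_cases k <;> simp at hik ⊢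
  have hoff' : ∀ i : Fin 3, (![1, 1, -1] : Fin 3 → ℝ) i * -1 = -1 ∨
      (![-1, 1, -1] : Fin 3 → ℝ) i * 1 = -1 := by
    intro i
    fin_cases i <;> simp
  have hAA : ∀ i k, l2Inner (Rc c) (symField c (.inl (.inl i))) (symField c (.inl (.inl k))) =
      if i = k then metricA i c else 0 := by
    intro i k
    split_ifs with h
    · rw [← h, metricA_eq]
    · exact hz _ _ (hoff i k h)
  have hDD : ∀ i k, l2Inner (Rc c) (symField c (.inl (.inr i))) (symField c (.inl (.inr k))) =
      if i = k then metricD i c else 0 := by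
    intro i k
    split_ifs with h
    · rw [← h, metricD_eq]
    · exact hz _ _ (hoff i k h)
  -- The factor `2` in `metricF` accounts for both cross terms, so each of them contributes half.
  have hAD : ∀ i k, l2Inner (Rc c) (symField c (.inl (.inl i))) (symField c (.inl (.inr k))) =
      if i = k then metricF i c / 2 else 0 := by
    intro i k
    split_ifs with h
    · rw [← h, metricF_eq]; ring
    · exact hz _ _ (hoff i k h)
  have hDA : ∀ i k, l2Inner (Rc c) (symField c (.inl (.inr i))) (symField c (.inl (.inl k))) =
      if i = k then metricF i c / 2 else 0 := by
    intro i k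
    split_ifs with h
    · rw [← h, hcomm, metricF_eq]; ring
    · exact hz _ _ (hoff i k h)
  have hXC : ∀ x u, l2Inner (Rc c) (symField c (.inl x)) (symField c (.inr u)) = 0 := by
    rintro (i | i) u <;> exact hz _ _ (hoff' i)
  have hCX : ∀ x u, l2Inner (Rc c) (symField c (.inr u)) (symField c (.inl x)) = 0 := by
    intro x u
    rw [l2Inner_comm, hXC]
  simp only [Fintype.sum_sum_type, Sum.elim_inl, Sum.elim_inr, hAA, hDD, hAD, hDA, hXC, hCX,
    mul_ite, mul_zero, Finset.sum_ite_eq, Finset.mem_univ, if_true, Finset.sum_const_zero,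
    add_zero, zero_add, Finset.univ_unique, Finset.sum_singleton]
  rw [add_comm, ← Finset.sum_add_distrib]
  congr 1
  · rw [show (default : Unit) = () from rfl, ← metricC_eq]; ring
  · refine Finset.sum_congr rfl fun i _ => ?_
    ring

/-! ### The metric on the symmetry orbits -/

/-- A unitary matrix preserves the norm of `(z, 1)`. This is what makes the Möbius action isometric
for the round metric. -/
lemma norm_sq_add_norm_sq_of_mem_specialUnitaryGroup {A : Matrix (Fin 2) (Fin 2) ℂ}
    (hA : A ∈ Matrix.specialUnitaryGroup (Fin 2) ℂ) (z : ℂ) :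
    ‖A 0 0 * z + A 0 1‖ ^ 2 + ‖A 1 0 * z + A 1 1‖ ^ 2 = 1 + ‖z‖ ^ 2 := by
  have h := (Matrix.mem_unitaryGroup_iff').1 (Matrix.mem_specialUnitaryGroup_iff.1 hA).1
  have h00 := congrFun (congrFun h 0) 0
  have h01 := congrFun (congrFun h 0) 1
  have h10 := congrFun (congrFun h 1) 0
  have h11 := congrFun (congrFun h 1) 1
  simp only [Matrix.mul_apply, Fin.sum_univ_two, Matrix.star_apply, RCLike.star_def,
    Matrix.one_apply_eq, Matrix.one_apply_ne (zero_ne_one : (0 : Fin 2) ≠ 1),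
    Matrix.one_apply_ne (one_ne_zero : (1 : Fin 2) ≠ 0)] at h00 h01 h10 h11
  have key : ∀ x : ℂ, ((‖x‖ ^ 2 : ℝ) : ℂ) = x * conj x := fun x => by
    rw [Complex.mul_conj, Complex.normSq_eq_norm_sq]
  have : ((‖A 0 0 * z + A 0 1‖ ^ 2 + ‖A 1 0 * z + A 1 1‖ ^ 2 : ℝ) : ℂ) =
      ((1 + ‖z‖ ^ 2 : ℝ) : ℂ) := by
    rw [Complex.ofReal_add, Complex.ofReal_add, key, key, key, Complex.ofReal_one]
    simp only [map_add, map_mul]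
    linear_combination z * conj z * h00 + conj z * h01 + z * h10 + h11
  exact_mod_cast this

lemma det_eq_one_of_mem_specialUnitaryGroup {A : Matrix (Fin 2) (Fin 2) ℂ}
    (hA : A ∈ Matrix.specialUnitaryGroup (Fin 2) ℂ) :
    A 0 0 * A 1 1 - A 0 1 * A 1 0 = 1 := by
  rw [← Matrix.det_fin_two]
  exact (Matrix.mem_specialUnitaryGroup_iff.1 hA).2

/-- A pole of `M` at the image point needs no exclusion: both sides are then `0`. -/
lemma affine_orbitMap {U M : GL (Fin 2) ℂ} {c : ℝ} {z w : ℂ}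
    (hz : (U : Matrix (Fin 2) (Fin 2) ℂ) 1 0 * z + (U : Matrix (Fin 2) (Fin 2) ℂ) 1 1 ≠ 0)
    (hw : w = ((U : Matrix (Fin 2) (Fin 2) ℂ) 0 0 * z + (U : Matrix (Fin 2) (Fin 2) ℂ) 0 1) /
      ((U : Matrix (Fin 2) (Fin 2) ℂ) 1 0 * z + (U : Matrix (Fin 2) (Fin 2) ℂ) 1 1))
    (hq : (c : ℂ) * w ^ 2 + 1 ≠ 0) :
    affine (orbitMap U M c) z =
      ((M : Matrix (Fin 2) (Fin 2) ℂ) 0 0 * affine (Rc c) w +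
        (M : Matrix (Fin 2) (Fin 2) ℂ) 0 1) /
      ((M : Matrix (Fin 2) (Fin 2) ℂ) 1 0 * affine (Rc c) w +
        (M : Matrix (Fin 2) (Fin 2) ℂ) 1 1) := by
  have h1 : Rc c (w : OnePoint ℂ) = ((affine (Rc c) w : ℂ) : OnePoint ℂ) := by
    rw [affine, Rc, ratMap_coe, if_neg (by simpa using hq)]
    simp
  rw [affine, orbitMap, OnePoint.smul_some_eq_ite, if_neg hz, ← hw, h1,
    OnePoint.smul_some_eq_ite]
  split_ifs with h
  · rw [h, div_zero]; simp
  · simp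

/-- The left side is the velocity at `z` of the Möbius flow generated by `su2 σ`; it ties the Pauli
basis to the fields `v_i`. -/
lemma su2_field (σ : Fin 3 → ℝ) (z : ℂ) :
    su2 σ 0 1 + (su2 σ 0 0 - su2 σ 1 1) * z - su2 σ 1 0 * z ^ 2 =
      ∑ i, (σ i : ℂ) * rotField i z := by
  simp [su2, su2Basis, rotField, Fin.sum_univ_three, Matrix.add_apply]
  ring

/-- The deformation of the symmetric map by rotations and a change of the parameter. -/
def orbitField (c c' : ℝ) (σ η : Fin 3 → ℝ) (w : ℂ) : ℂ :=
  ∑ x, ((Sum.elim (Sum.elim σ η) (fun _ => c') x : ℝ) : ℂ) * symField c x w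

lemma orbitField_eq (c c' : ℝ) (σ η : Fin 3 → ℝ) (w : ℂ) : orbitField c c' σ η w =
    (∑ i, (σ i : ℂ) * rotField i w) * deriv (affine (Rc c)) w +
      c' * deriv (fun s : ℝ => affine (Rc s) w) c +
      ∑ i, (η i : ℂ) * rotField i (affine (Rc c) w) := by
  simp only [orbitField, Fintype.sum_sum_type, Sum.elim_inl, Sum.elim_inr, symField,
    Finset.univ_unique, Finset.sum_singleton, Finset.sum_mul, mul_assoc]
  ring

section Orbit

variable {U M : ℝ → GL (Fin 2) ℂ} {c : ℝ → ℝ} {t₀ c' : ℝ} {σ η : Fin 3 → ℝ}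

/-- The domain rotation generates the rotation fields. -/
lemma hasDerivAt_domain
    (hU : ∀ a b, HasDerivAt (fun t => (U t : Matrix (Fin 2) (Fin 2) ℂ) a b)
        ((su2 σ * (U t₀ : Matrix (Fin 2) (Fin 2) ℂ)) a b) t₀) {z w : ℂ}
    (hz : (U t₀ : Matrix (Fin 2) (Fin 2) ℂ) 1 0 * z + (U t₀ : Matrix (Fin 2) (Fin 2) ℂ) 1 1 ≠ 0)
    (hw : w = ((U t₀ : Matrix (Fin 2) (Fin 2) ℂ) 0 0 * z + (U t₀ : Matrix (Fin 2) (Fin 2) ℂ) 0 1) /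
      ((U t₀ : Matrix (Fin 2) (Fin 2) ℂ) 1 0 * z + (U t₀ : Matrix (Fin 2) (Fin 2) ℂ) 1 1)) :
    HasDerivAt (fun t =>
      ((U t : Matrix (Fin 2) (Fin 2) ℂ) 0 0 * z + (U t : Matrix (Fin 2) (Fin 2) ℂ) 0 1) /
      ((U t : Matrix (Fin 2) (Fin 2) ℂ) 1 0 * z + (U t : Matrix (Fin 2) (Fin 2) ℂ) 1 1))
      (∑ i, (σ i : ℂ) * rotField i w) t₀ := by
  have hn := ((hU 0 0).mul_const z).fun_add (hU 0 1)
  have hd := ((hU 1 0).mul_const z).fun_add (hU 1 1)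
  refine (hn.div hd hz).congr_deriv ?_
  rw [← su2_field, hw]
  simp only [Matrix.mul_apply, Fin.sum_univ_two]
  obtain ⟨d, hd⟩ : ∃ d, d = (U t₀ : Matrix (Fin 2) (Fin 2) ℂ) 1 0 * z +
    (U t₀ : Matrix (Fin 2) (Fin 2) ℂ) 1 1 := ⟨_, rfl⟩
  obtain ⟨n, hn⟩ : ∃ n, n = (U t₀ : Matrix (Fin 2) (Fin 2) ℂ) 0 0 * z +
    (U t₀ : Matrix (Fin 2) (Fin 2) ℂ) 0 1 := ⟨_, rfl⟩
  rw [← hd] at hz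
  rw [← hd, ← hn]
  -- With `U' = su2 σ · U`, the velocity of the vector `(n, d) = U (z, 1)` is `su2 σ (n, d)`, so the
  -- field depends only on `w = n / d`.
  have e0 : ∀ p q : ℂ, (p * (U t₀ : Matrix (Fin 2) (Fin 2) ℂ) 0 0 +
      q * (U t₀ : Matrix (Fin 2) (Fin 2) ℂ) 1 0) * z +
      (p * (U t₀ : Matrix (Fin 2) (Fin 2) ℂ) 0 1 + q * (U t₀ : Matrix (Fin 2) (Fin 2) ℂ) 1 1) =
      p * n + q * d := by
    intro p q; rw [hd, hn]; ring
  rw [e0, e0]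
  field_simp
  ring

/-- The chain rule for the symmetric maps. -/
lemma hasDerivAt_affine_Rc_comp {w : ℝ → ℂ} {w' : ℂ} (hc : HasDerivAt c c' t₀)
    (hw : HasDerivAt w w' t₀) (hq : (c t₀ : ℂ) * w t₀ ^ 2 + 1 ≠ 0) :
    HasDerivAt (fun t => affine (Rc (c t)) (w t))
      (w' * deriv (affine (Rc (c t₀))) (w t₀) +
        c' * deriv (fun s : ℝ => affine (Rc s) (w t₀)) (c t₀)) t₀ := by
  rw [(hasDerivAt_affine_Rc hq).deriv, (hasDerivAt_affine_Rc_param hq).deriv]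
  simp only [affine_Rc]
  have hc' : HasDerivAt (fun t => (c t : ℂ)) c' t₀ := hc.ofReal_comp
  have h1 := (hw.fun_pow 3).fun_add (hc'.fun_mul hw)
  have h2 := (hc'.fun_mul (hw.fun_pow 2)).add_const 1
  refine (h1.div h2 hq).congr_deriv ?_
  rw [mul_div_assoc', mul_div_assoc', ← add_div]
  congr 1
  push_cast
  ring

/-- The target rotation generates the rotation fields at the image point. -/
lemma hasDerivAt_target (hdet : (M t₀ : Matrix (Fin 2) (Fin 2) ℂ) 0 0 *
      (M t₀ : Matrix (Fin 2) (Fin 2) ℂ) 1 1 -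
      (M t₀ : Matrix (Fin 2) (Fin 2) ℂ) 0 1 * (M t₀ : Matrix (Fin 2) (Fin 2) ℂ) 1 0 = 1)
    (hM : ∀ a b, HasDerivAt (fun t => (M t : Matrix (Fin 2) (Fin 2) ℂ) a b)
        (((M t₀ : Matrix (Fin 2) (Fin 2) ℂ) * su2 η) a b) t₀) {r : ℝ → ℂ} {r' : ℂ}
    (hr : HasDerivAt r r' t₀)
    (hm : (M t₀ : Matrix (Fin 2) (Fin 2) ℂ) 1 0 * r t₀ +
      (M t₀ : Matrix (Fin 2) (Fin 2) ℂ) 1 1 ≠ 0) :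
    HasDerivAt (fun t =>
      ((M t : Matrix (Fin 2) (Fin 2) ℂ) 0 0 * r t + (M t : Matrix (Fin 2) (Fin 2) ℂ) 0 1) /
      ((M t : Matrix (Fin 2) (Fin 2) ℂ) 1 0 * r t + (M t : Matrix (Fin 2) (Fin 2) ℂ) 1 1))
      ((r' + ∑ i, (η i : ℂ) * rotField i (r t₀)) /
        ((M t₀ : Matrix (Fin 2) (Fin 2) ℂ) 1 0 * r t₀ +
          (M t₀ : Matrix (Fin 2) (Fin 2) ℂ) 1 1) ^ 2) t₀ := by
  have hn := ((hM 0 0).fun_mul hr).fun_add (hM 0 1)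
  have hd := ((hM 1 0).fun_mul hr).fun_add (hM 1 1)
  refine (hn.div hd hm).congr_deriv ?_
  rw [← su2_field]
  simp only [Matrix.mul_apply, Fin.sum_univ_two]
  congr 1
  -- As `M' = M · su2 η`, the rotation by `η` acts before `M`; the derivative of the transformation
  -- `M` contributes `det M = 1` over the squared denominator.
  linear_combination (r' + su2 η 0 1 + (su2 η 0 0 - su2 η 1 1) * r t₀ -
    su2 η 1 0 * r t₀ ^ 2) * hdet

/-- The deformation tangent to the orbits, transported to the symmetric map. -/
lemma deriv_affine_orbitMap (hdet : (M t₀ : Matrix (Fin 2) (Fin 2) ℂ) 0 0 *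
      (M t₀ : Matrix (Fin 2) (Fin 2) ℂ) 1 1 -
      (M t₀ : Matrix (Fin 2) (Fin 2) ℂ) 0 1 * (M t₀ : Matrix (Fin 2) (Fin 2) ℂ) 1 0 = 1)
    (hc : HasDerivAt c c' t₀)
    (hU : ∀ a b, HasDerivAt (fun t => (U t : Matrix (Fin 2) (Fin 2) ℂ) a b)
        ((su2 σ * (U t₀ : Matrix (Fin 2) (Fin 2) ℂ)) a b) t₀)
    (hM : ∀ a b, HasDerivAt (fun t => (M t : Matrix (Fin 2) (Fin 2) ℂ) a b)
        (((M t₀ : Matrix (Fin 2) (Fin 2) ℂ) * su2 η) a b) t₀) {z w : ℂ}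
    (hz : (U t₀ : Matrix (Fin 2) (Fin 2) ℂ) 1 0 * z + (U t₀ : Matrix (Fin 2) (Fin 2) ℂ) 1 1 ≠ 0)
    (hw : w = ((U t₀ : Matrix (Fin 2) (Fin 2) ℂ) 0 0 * z + (U t₀ : Matrix (Fin 2) (Fin 2) ℂ) 0 1) /
      ((U t₀ : Matrix (Fin 2) (Fin 2) ℂ) 1 0 * z + (U t₀ : Matrix (Fin 2) (Fin 2) ℂ) 1 1))
    (hq : (c t₀ : ℂ) * w ^ 2 + 1 ≠ 0)
    (hm : (M t₀ : Matrix (Fin 2) (Fin 2) ℂ) 1 0 * affine (Rc (c t₀)) w +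
      (M t₀ : Matrix (Fin 2) (Fin 2) ℂ) 1 1 ≠ 0) :
    deriv (fun t => affine (orbitMap (U t) (M t) (c t)) z) t₀ =
      orbitField (c t₀) c' σ η w / ((M t₀ : Matrix (Fin 2) (Fin 2) ℂ) 1 0 * affine (Rc (c t₀)) w +
        (M t₀ : Matrix (Fin 2) (Fin 2) ℂ) 1 1) ^ 2 := by
  set W : ℝ → ℂ := fun t =>
    ((U t : Matrix (Fin 2) (Fin 2) ℂ) 0 0 * z + (U t : Matrix (Fin 2) (Fin 2) ℂ) 0 1) /
      ((U t : Matrix (Fin 2) (Fin 2) ℂ) 1 0 * z + (U t : Matrix (Fin 2) (Fin 2) ℂ) 1 1) with hWdef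
  have hW0 : w = W t₀ := hw
  have hW := hasDerivAt_domain hU hz hw
  rw [hW0] at hq hm hW ⊢
  have hr := hasDerivAt_affine_Rc_comp hc hW hq
  have hfin := hasDerivAt_target hdet hM hr hm
  rw [orbitField_eq]
  refine (hfin.congr_of_eventuallyEq ?_).deriv
  have e1 : ∀ᶠ t in nhds t₀, (U t : Matrix (Fin 2) (Fin 2) ℂ) 1 0 * z +
      (U t : Matrix (Fin 2) (Fin 2) ℂ) 1 1 ≠ 0 :=
    (((hU 1 0).mul_const z).fun_add (hU 1 1)).continuousAt.eventually_ne hz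
  have e2 : ∀ᶠ t in nhds t₀, (c t : ℂ) * W t ^ 2 + 1 ≠ 0 :=
    ((hc.ofReal_comp.fun_mul (hW.fun_pow 2)).add_const 1).continuousAt.eventually_ne hq
  filter_upwards [e1, e2] with t h1 h2
  exact affine_orbitMap h1 rfl h2

/-- The poles of `R_c` and of `M ∘ R_c`, outside which the chain rule applies; `U` pulls them back
injectively to a finite, hence null, set. -/
lemma finite_orbit_poles {m m' c : ℂ} (hm : m ≠ 0 ∨ m' ≠ 0) :
    {w : ℂ | c * w ^ 2 + 1 = 0 ∨ m * (w ^ 3 + c * w) + m' * (c * w ^ 2 + 1) = 0}.Finite := by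
  have h1 : (C c * X ^ 2 + 1 : ℂ[X]) ≠ 0 := by
    intro h
    have := congrArg (eval 0) h
    simp at this
  have h2 : (C m * (X ^ 3 + C c * X) + C m' * (C c * X ^ 2 + 1) : ℂ[X]) ≠ 0 := by
    intro h
    rcases hm with hm | hm
    · have := congrArg (fun p => p.coeff 3) h
      simp [coeff_one] at this
      exact hm this
    · have := congrArg (eval 0) h
      simp at this
      exact hm this
  have f1 := finite_setOfPred_isRoot h1
  have f2 := finite_setOfPred_isRoot h2
  refine (f1.union f2).subset ?_
  rintro w (h | h)
  · left; simpa [IsRoot] using h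
  · right; simpa [IsRoot] using h

/-- The `L²` metric on the symmetry orbits. -/
theorem l2Inner_orbitMap
    (hUS : (U t₀ : Matrix (Fin 2) (Fin 2) ℂ) ∈ Matrix.specialUnitaryGroup (Fin 2) ℂ)
    (hMS : (M t₀ : Matrix (Fin 2) (Fin 2) ℂ) ∈ Matrix.specialUnitaryGroup (Fin 2) ℂ)
    (hc0 : 0 ≤ c t₀) (hc1 : c t₀ ≠ 1) (hc : HasDerivAt c c' t₀)
    (hU : ∀ a b, HasDerivAt (fun t => (U t : Matrix (Fin 2) (Fin 2) ℂ) a b)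
        ((su2 σ * (U t₀ : Matrix (Fin 2) (Fin 2) ℂ)) a b) t₀)
    (hM : ∀ a b, HasDerivAt (fun t => (M t : Matrix (Fin 2) (Fin 2) ℂ) a b)
        (((M t₀ : Matrix (Fin 2) (Fin 2) ℂ) * su2 η) a b) t₀) :
    l2Inner (orbitMap (U t₀) (M t₀) (c t₀))
        (fun z => deriv (fun t => affine (orbitMap (U t) (M t) (c t)) z) t₀)
        (fun z => deriv (fun t => affine (orbitMap (U t) (M t) (c t)) z) t₀) =
      metricC (c t₀) * c' ^ 2 +
        ∑ i, (metricA i (c t₀) * σ i ^ 2 + metricD i (c t₀) * η i ^ 2 +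
          metricF i (c t₀) * (σ i * η i)) := by
  rw [← l2Inner_symField hc0 hc1 σ η c' (V := orbitField (c t₀) c' σ η) rfl]
  have hdU := det_eq_one_of_mem_specialUnitaryGroup hUS
  have hdM := det_eq_one_of_mem_specialUnitaryGroup hMS
  rw [l2Inner, l2Inner, integral_moebius hdU (l2Density (Rc (c t₀)) _ _)]
  refine integral_congr_ae ?_
  have hpole : (M t₀ : Matrix (Fin 2) (Fin 2) ℂ) 1 0 ≠ 0 ∨
      (M t₀ : Matrix (Fin 2) (Fin 2) ℂ) 1 1 ≠ 0 := by
    by_contra! h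
    rw [h.1, h.2] at hdM
    simp at hdM
  have hgood : ∀ᵐ z : ℂ, ¬ (z ∈ {z | (U t₀ : Matrix (Fin 2) (Fin 2) ℂ) 1 0 * z +
      (U t₀ : Matrix (Fin 2) (Fin 2) ℂ) 1 1 ≠ 0} ∧
      ((U t₀ : Matrix (Fin 2) (Fin 2) ℂ) 0 0 * z + (U t₀ : Matrix (Fin 2) (Fin 2) ℂ) 0 1) /
      ((U t₀ : Matrix (Fin 2) (Fin 2) ℂ) 1 0 * z + (U t₀ : Matrix (Fin 2) (Fin 2) ℂ) 1 1) ∈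
      {w : ℂ | (c t₀ : ℂ) * w ^ 2 + 1 = 0 ∨ (M t₀ : Matrix (Fin 2) (Fin 2) ℂ) 1 0 *
        (w ^ 3 + c t₀ * w) + (M t₀ : Matrix (Fin 2) (Fin 2) ℂ) 1 1 * (c t₀ * w ^ 2 + 1) = 0}) := by
    rw [ae_iff]
    simp only [not_not]
    refine Set.Finite.measure_zero ?_ _
    exact Set.Finite.of_injOn (fun z hz => hz.2)
      ((injOn_moebius hdU).mono fun z hz => hz.1) (finite_orbit_poles hpole)
  filter_upwards [ae_moebius_den_ne_zero hdU, hgood] with z hz hg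
  obtain ⟨w, hw⟩ : ∃ w, w =
    ((U t₀ : Matrix (Fin 2) (Fin 2) ℂ) 0 0 * z + (U t₀ : Matrix (Fin 2) (Fin 2) ℂ) 0 1) /
      ((U t₀ : Matrix (Fin 2) (Fin 2) ℂ) 1 0 * z + (U t₀ : Matrix (Fin 2) (Fin 2) ℂ) 1 1) :=
    ⟨_, rfl⟩
  rw [← hw] at hg ⊢
  simp only [hz, not_false_eq_true, true_and, ne_eq, not_or] at hg
  obtain ⟨hq, hg⟩ := hg
  have hm : (M t₀ : Matrix (Fin 2) (Fin 2) ℂ) 1 0 * affine (Rc (c t₀)) w +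
      (M t₀ : Matrix (Fin 2) (Fin 2) ℂ) 1 1 ≠ 0 := by
    intro h
    apply hg
    rw [affine_Rc] at h
    have h' := congrArg (· * ((c t₀ : ℂ) * w ^ 2 + 1)) h
    simp only [zero_mul] at h'
    rw [← h', add_mul, mul_assoc, div_mul_cancel₀ _ hq]
  have hM1 := norm_sq_add_norm_sq_of_mem_specialUnitaryGroup hMS (affine (Rc (c t₀)) w)
  have hU1 := norm_sq_add_norm_sq_of_mem_specialUnitaryGroup hUS z
  rw [l2Density, l2Density, Complex.mul_conj, Complex.mul_conj, Complex.ofReal_re,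
    Complex.ofReal_re, Complex.normSq_eq_norm_sq, Complex.normSq_eq_norm_sq,
    deriv_affine_orbitMap hdM hc hU hM hz hw hq hm, affine_orbitMap hz hw hq]
  set r := affine (Rc (c t₀)) w
  set V := orbitField (c t₀) c' σ η w
  set d := (U t₀ : Matrix (Fin 2) (Fin 2) ℂ) 1 0 * z + (U t₀ : Matrix (Fin 2) (Fin 2) ℂ) 1 1
  set m := (M t₀ : Matrix (Fin 2) (Fin 2) ℂ) 1 0 * r + (M t₀ : Matrix (Fin 2) (Fin 2) ℂ) 1 1
  have hd0 : ‖d‖ ≠ 0 := norm_ne_zero_iff.2 hz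
  have hm0 : ‖m‖ ≠ 0 := norm_ne_zero_iff.2 hm
  -- The factor `|m|⁴` cancels against the derivative of the target rotation, and `|d|⁴` in the same
  -- way against the Jacobian of `z ↦ w`.
  have eM : 1 + ‖((M t₀ : Matrix (Fin 2) (Fin 2) ℂ) 0 0 * r +
      (M t₀ : Matrix (Fin 2) (Fin 2) ℂ) 0 1) / m‖ ^ 2 = (1 + ‖r‖ ^ 2) / ‖m‖ ^ 2 := by
    rw [norm_div, ← hM1]
    field_simp
    ring
  have eU : 1 + ‖w‖ ^ 2 = (1 + ‖z‖ ^ 2) / ‖d‖ ^ 2 := by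
    rw [hw, norm_div, ← hU1]
    field_simp
    ring
  have hr0 : 1 + ‖r‖ ^ 2 ≠ 0 := by positivity
  have hz0 : 1 + ‖z‖ ^ 2 ≠ 0 := by positivity
  rw [eM, eU, norm_div, norm_pow]
  field_simp

end Orbit

end Lump

end

theorem mainTheorem3 :
    -- the `L²` metric is well defined in every coordinate system of the moduli space
    (∀ (j : Fin 8), ∀ y ∈ Lump.lumpDom j, ∀ k l : Fin 7,
      MeasureTheory.Integrable (Lump.l2Density (Lump.lumpChart j y)
        (Lump.partialField (Lump.lumpChart j) y k)
        (Lump.partialField (Lump.lumpChart j) y l))) ∧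
    -- on the symmetry orbits it is `C dc² + ∑ (A_ii σ_i² + D_ii η_i² + F_ii σ_i η_i)`
    (∀ (U M : ℝ → GL (Fin 2) ℂ) (c : ℝ → ℝ) (t₀ c' : ℝ) (σ η : Fin 3 → ℝ),
      (∀ t, (U t : Matrix (Fin 2) (Fin 2) ℂ) ∈ Matrix.specialUnitaryGroup (Fin 2) ℂ) →
      (∀ t, (M t : Matrix (Fin 2) (Fin 2) ℂ) ∈ Matrix.specialUnitaryGroup (Fin 2) ℂ) →
      0 ≤ c t₀ → c t₀ ≠ 1 → HasDerivAt c c' t₀ →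
      (∀ a b, HasDerivAt (fun t => (U t : Matrix (Fin 2) (Fin 2) ℂ) a b)
        ((Lump.su2 σ * (U t₀ : Matrix (Fin 2) (Fin 2) ℂ)) a b) t₀) →
      (∀ a b, HasDerivAt (fun t => (M t : Matrix (Fin 2) (Fin 2) ℂ) a b)
        (((M t₀ : Matrix (Fin 2) (Fin 2) ℂ) * Lump.su2 η) a b) t₀) →
      Lump.l2Inner (Lump.orbitMap (U t₀) (M t₀) (c t₀))
          (fun z => deriv (fun t => Lump.affine (Lump.orbitMap (U t) (M t) (c t)) z) t₀)
          (fun z => deriv (fun t => Lump.affine (Lump.orbitMap (U t) (M t) (c t)) z) t₀) =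
        Lump.metricC (c t₀) * c' ^ 2 +
          ∑ i, (Lump.metricA i (c t₀) * σ i ^ 2 + Lump.metricD i (c t₀) * η i ^ 2 +
            Lump.metricF i (c t₀) * (σ i * η i))) ∧
    -- the volume of the moduli space is finite
    Lump.lumpVolume < ⊤ := by
  exact ⟨fun j y hy k l => Lump.integrable_l2Density_lumpChart hy k l,
    fun U M c t₀ c' σ η hUS hMS hc0 hc1 hc hU hM =>
      Lump.l2Inner_orbitMap (hUS t₀) (hMS t₀) hc0 hc1 hc hU hM,
    Lump.lumpVolume_lt_top⟩
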